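/- Consider a data-generating system $y(t)=G^0(q)u(t)+H^0(q)e(t)$, $t\in\mathbb Z$, with $q$ the forward shift, $y(t),e(t)\in\mathbb R^p$, $u(t)\in\mathbb R^m$, where $G^0$ is a proper stable real rational transfer matrix, $H^0$ is a rational noise model that is monic (proper with $H^0(\infty)=I$), stable and stably invertible, $e$ is a vector white-noise process, $e(t)$ is uncorrelated with $u(s)$ for all $s\le t$, and $\kappa(t)=\begin{bmatrix}u(t)\\ e(t)\end{bmatrix}$ is quasi-stationary: its second moments are uniformly bounded and $R_\kappa(\tau)=\bar{\mathbb E}\,\kappa(t)\kappa(t-\tau)^T$ exists for all $\tau$, where $\bar{\mathbb E}f(t)=\lim_{N\to\infty}\frac1N\sum_{t=1}^N\mathbb E f(t)$. Let $(G(q,\theta),H(q,\theta))_{\theta\in\Theta}$, $\Theta\subset\mathbb R^n$, be a parametrized model with $G(q,\theta)$ rational, proper and stable and $H(q,\theta)$ rational, monic, stable and stably invertible for each $\theta\in\Theta$. Put $M(q,\theta)=[G(q,\theta)\ \ H(q,\theta)]$ and $M^0=[G^0\ \ H^0]$, and suppose that the system is in the model set, i.e. $M(q,\theta_0)=M^0(q)$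 for some $\theta_0\in\Theta$. Let $\varepsilon(t,\theta)=y(t)-\hat y(t|t-1;\theta)=H(q,\theta)^{-1}[y(t)-G(q,\theta)u(t)]$ be the one-step-ahead prediction error, with $\hat y(t|t-1;\theta)=(I-H(q,\theta)^{-1})y(t)+H(q,\theta)^{-1}G(q,\theta)u(t)$, and let $V(\theta)=\bar{\mathbb E}\,\varepsilon^T(t,\theta)Q\varepsilon(t,\theta)$ be the cost, with $Q$ a positive definite weighting matrix. Fix a row index $j$ and suppose that row $M_j(q,\theta)$ shares no parameters with the other rows: there is a set $I$ of parameter indices such that on $\Theta$ row $j$ depends only on the $\theta_i$ with $i\in I$ and the other rows depend only on the $\theta_i$ with $i\notin I$. Let $\kappa^{[j]}$ consist of the components of $\kappa$ that correspond either to the columns of those entries of row $M_j(q,\theta)$ that are not identically zero over $\Theta$, or just to the columns of the parametrized entries of that row, i.e. those that are not one and the same transfer function for all $\theta\in\Theta$. Suppose that $\kappa^{[j]}$ has a spectral density, i.e. an integrable matrix function $\Phi_{\kappa^{[j]}}$ on $(-\pi,\pi]$ with $\bar{\mathbb E}\,\kappa^{[j]}(t)\kappa^{[j]}(t-\tau)^T=\frac1{2\pi}\int_{-\pi}^{\pi}\Phi_{\kappa^{[j]}}(\omega)e^{i\omega\tau}\,d\omega$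 for all $\tau\in\mathbb Z$, and that $\Phi_{\kappa^{[j]}}(\omega)\succ0$ for almost all $\omega$. Then $V(\theta)$ exists for every $\theta\in\Theta$, and $M_j(q,\theta)=M_j^0(q)$ is unique at the minimum of $V$ over $\Theta$: $V$ has a minimizer in $\Theta$, and every minimizer $\theta^*\in\Theta$ satisfies $M_j(q,\theta^*)=M_j^0(q)$. -/

import Mathlib

open MeasureTheory Filter Topology
open scoped ComplexOrder

noncomputable section

namespace PredErr

/-! ### Rational transfer functions in the forward shift `q` -/

/-- The expansion of a rational function of `q` in the field of Laurent series in `q⁻¹`: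
`HahnSeries.single 1 1` is `q⁻¹`, so that `q` is sent to `HahnSeries.single (-1) 1`. -/
def expansion (F : RatFunc ℝ) : LaurentSeries ℝ :=
  F.eval (HahnSeries.C : ℝ →+* LaurentSeries ℝ) (HahnSeries.single (-1 : ℤ) (1 : ℝ))

/-- The impulse response of `F`: the coefficient of `q ^ (-k)` in the expansion of `F`. -/
def impulse (F : RatFunc ℝ) (k : ℕ) : ℝ :=
  HahnSeries.coeff (expansion F) (k : ℤ)

/-- `F` is proper: it has no pole at infinity. -/
def IsProper (F : RatFunc ℝ) : Prop :=
  F.num.natDegree ≤ F.denom.natDegree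

/-- `F` is (causal and) stable: it is proper and all its poles lie in the open unit disc. -/
def IsStable (F : RatFunc ℝ) : Prop :=
  IsProper F ∧ ∀ z : ℂ, 1 ≤ ‖z‖ → Polynomial.aeval z F.denom ≠ 0

/-- A transfer matrix is stable if all its entries are. -/
def IsStableMatrix {α β : Type*} (F : Matrix α β (RatFunc ℝ)) : Prop :=
  ∀ a b, IsStable (F a b)

/-- A square transfer matrix is monic if it is proper with value the identity matrix at `q = ∞`. -/
def IsMonic {p : ℕ} (H : Matrix (Fin p) (Fin p) (RatFunc ℝ)) : Prop :=
  (∀ a b, IsProper (H a b)) ∧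
    ∀ a b, impulse (H a b) 0 = (1 : Matrix (Fin p) (Fin p) ℝ) a b

/-- Noise models: monic, stable and stably invertible. -/
structure IsNoiseModel {p : ℕ} (H : Matrix (Fin p) (Fin p) (RatFunc ℝ)) : Prop where
  monic : IsMonic H
  stable : IsStableMatrix H
  invertible : IsUnit H.det
  stable_inv : IsStableMatrix H⁻¹

/-! ### Signals, filtering and generalized expectation -/

/-- The filtered signal `(F(q) s)(t) = ∑_{k ≥ 0} f(k) s(t - k)`, with `f` the impulse response
of the transfer matrix `F`. -/
def filt {Ω α β : Type*} [Fintype β] (F : Matrix α β (RatFunc ℝ)) (s : ℤ → Ω → β → ℝ) :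
    ℤ → Ω → α → ℝ :=
  fun t ω a => ∑ b, ∑' k : ℕ, impulse (F a b) k * s (t - k) ω b

/-- `f` has generalized expectation `L`, that is
`lim_{N → ∞} (1 / N) ∑_{t = 1}^N 𝔼 f(t) = L`, all the expectations being well defined. -/
def HasGenExp {Ω : Type*} [MeasurableSpace Ω] (P : Measure Ω) (f : ℤ → Ω → ℝ) (L : ℝ) : Prop :=
  (∀ t, Integrable (f t) P) ∧
    Tendsto (fun N : ℕ => (N : ℝ)⁻¹ * ∑ t ∈ Finset.Icc 1 N, ∫ ω, f (t : ℤ) ω ∂P) atTop (𝓝 L)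

/-- `R(τ)` is the generalized expectation of `s(t) s(t - τ)ᵀ`, for every `τ`. -/
def HasCovariance {Ω ι : Type*} [MeasurableSpace Ω] (P : Measure Ω) (s : ℤ → Ω → ι → ℝ)
    (R : ℤ → Matrix ι ι ℝ) : Prop :=
  ∀ τ a b, HasGenExp P (fun t ω => s t ω a * s (t - τ) ω b) (R τ a b)

/-- Quasi-stationary vector signals: uniformly bounded second moments, and the time averages
that define the covariance function converge. A deterministic signal is one that does not depend
on `ω`. -/
structure IsQuasiStationary {Ω ι : Type*} [MeasurableSpace Ω] (P : Measure Ω)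
    (s : ℤ → Ω → ι → ℝ) : Prop where
  memLp : ∀ t a, MemLp (fun ω => s t ω a) 2 P
  bounded : ∃ C : ℝ, ∀ t a, ∫ ω, s t ω a ^ 2 ∂P ≤ C
  covariance : ∃ R : ℤ → Matrix ι ι ℝ, HasCovariance P s R

/-- `Φ` is the spectral density of the signal `s`: an integrable function on `(-π, π]` such that
the covariance function of `s` is
`R(τ) = (1 / 2π) ∫_{-π}^{π} Φ(ω) exp(iωτ) dω`
(`Φ(ω) = ∑_τ R(τ) exp(-iωτ)` whenever `R` is absolutely summable). -/
def HasSpectralDensity {Ω ι : Type*} [MeasurableSpace Ω] (P : Measure Ω)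
    (s : ℤ → Ω → ι → ℝ) (Φ : ℝ → Matrix ι ι ℂ) : Prop :=
  (∀ a b, IntegrableOn (fun w => Φ w a b) (Set.Ioc (-Real.pi) Real.pi)) ∧
    ∃ R : ℤ → Matrix ι ι ℝ, HasCovariance P s R ∧
      ∀ τ a b, ((R τ a b : ℝ) : ℂ) =
        (2 * (Real.pi : ℂ))⁻¹ *
          ∫ w in (-Real.pi)..Real.pi, Φ w a b * Complex.exp (Complex.I * w * τ)

/-- Vector white noise with covariance matrix `Λ`. -/
structure IsWhiteNoise {Ω ι : Type*} [MeasurableSpace Ω] (P : Measure Ω)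
    (e : ℤ → Ω → ι → ℝ) (Λ : Matrix ι ι ℝ) : Prop where
  memLp : ∀ t a, MemLp (fun ω => e t ω a) 2 P
  mean_zero : ∀ t a, ∫ ω, e t ω a ∂P = 0
  covariance : ∀ t a b, ∫ ω, e t ω a * e t ω b ∂P = Λ a b
  uncorrelated : ∀ s t, s ≠ t → ∀ a b, ∫ ω, e s ω a * e t ω b ∂P = 0

/-- The signal `κ(t)`, composed of `u(t)` and `e(t)`. -/
def kappa {Ω : Type*} {m p : ℕ} (u : ℤ → Ω → Fin m → ℝ) (e : ℤ → Ω → Fin p → ℝ) :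
    ℤ → Ω → Fin m ⊕ Fin p → ℝ :=
  fun t ω => Sum.elim (u t ω) (e t ω)

/-- The selection of the components of a vector signal with index in `S`. -/
def select {Ω ι : Type*} (S : Set ι) (s : ℤ → Ω → ι → ℝ) : ℤ → Ω → S → ℝ :=
  fun t ω c => s t ω c

/-! ### Predictor, prediction error and cost -/

/-- The one-step-ahead predictor `ŷ = (I - H⁻¹) y + H⁻¹ G u` of the model `(G, H)`. -/
def predictor {Ω : Type*} {m p : ℕ} (G : Matrix (Fin p) (Fin m) (RatFunc ℝ))
    (H : Matrix (Fin p) (Fin p) (RatFunc ℝ)) (y : ℤ → Ω → Fin p → ℝ) (u : ℤ → Ω → Fin m → ℝ) :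
    ℤ → Ω → Fin p → ℝ :=
  fun t ω => filt (1 - H⁻¹) y t ω + filt (H⁻¹ * G) u t ω

/-- The one-step-ahead prediction error `ε = y - ŷ`. -/
def predictionError {Ω : Type*} {m p : ℕ} (G : Matrix (Fin p) (Fin m) (RatFunc ℝ))
    (H : Matrix (Fin p) (Fin p) (RatFunc ℝ)) (y : ℤ → Ω → Fin p → ℝ) (u : ℤ → Ω → Fin m → ℝ) :
    ℤ → Ω → Fin p → ℝ :=
  fun t ω => y t ω - predictor G H y u t ω

/-- `V` is the prediction-error cost on the parameter set `Θ`: for every `θ ∈ Θ`, the generalized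
expectation of `ε(t, θ)ᵀ Q ε(t, θ)` exists and equals `V θ`. -/
def IsPredictionErrorCost {Ω : Type*} [MeasurableSpace Ω] (P : Measure Ω) {m p n : ℕ}
    (Θ : Set (Fin n → ℝ)) (G : (Fin n → ℝ) → Matrix (Fin p) (Fin m) (RatFunc ℝ))
    (H : (Fin n → ℝ) → Matrix (Fin p) (Fin p) (RatFunc ℝ)) (Q : Matrix (Fin p) (Fin p) ℝ)
    (y : ℤ → Ω → Fin p → ℝ) (u : ℤ → Ω → Fin m → ℝ) (V : (Fin n → ℝ) → ℝ) : Prop :=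
  ∀ θ ∈ Θ, HasGenExp P
    (fun t ω => predictionError (G θ) (H θ) y u t ω ⬝ᵥ
      Q.mulVec (predictionError (G θ) (H θ) y u t ω)) (V θ)

/-! ### Structure of the parametrized model -/

/-- `M(q, θ) = [G(q, θ)  H(q, θ)]`. -/
def modelMatrix {m p n : ℕ} (G : (Fin n → ℝ) → Matrix (Fin p) (Fin m) (RatFunc ℝ))
    (H : (Fin n → ℝ) → Matrix (Fin p) (Fin p) (RatFunc ℝ)) :
    (Fin n → ℝ) → Matrix (Fin p) (Fin m ⊕ Fin p) (RatFunc ℝ) :=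
  fun θ => Matrix.fromCols (G θ) (H θ)

/-- The parameters in row `j` are not shared with the other rows: there is a set `S` of parameter
indices such that row `j` depends only on the `θ i` with `i ∈ S`, and the other rows depend only on
the `θ i` with `i ∉ S`. -/
def RowIndependent {n : ℕ} {α β γ : Type*} (Θ : Set (Fin n → ℝ))
    (M : (Fin n → ℝ) → Matrix α β γ) (j : α) : Prop :=
  ∃ S : Set (Fin n),
    (∀ θ ∈ Θ, ∀ θ' ∈ Θ, (∀ i ∈ S, θ i = θ' i) → M θ j = M θ' j) ∧
    (∀ θ ∈ Θ, ∀ θ' ∈ Θ, (∀ i ∉ S, θ i = θ' i) → ∀ l, l ≠ j → M θ l = M θ' l)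

/-- The columns of the entries of row `j` that are not structurally zero. -/
def nonzeroColumns {n : ℕ} {α β γ : Type*} [Zero γ] (Θ : Set (Fin n → ℝ))
    (M : (Fin n → ℝ) → Matrix α β γ) (j : α) : Set β :=
  {c | ∃ θ ∈ Θ, M θ j c ≠ 0}

/-- The columns of the parametrized entries of row `j`, that is, of those entries that are not
one and the same (a priori known) transfer function for all `θ ∈ Θ`. -/
def parametrizedColumns {n : ℕ} {α β γ : Type*} (Θ : Set (Fin n → ℝ))
    (M : (Fin n → ℝ) → Matrix α β γ) (j : α) : Set β :=
  {c | ∃ θ ∈ Θ, ∃ θ' ∈ Θ, M θ j c ≠ M θ' j c}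

end PredErr

end

/-!
Filters with absolutely summable impulse response make the `L²`-bounded signals a module over the
Wiener algebra. As `y = M⁰ κ`, the prediction error is `ε = e + H⁻¹ (M⁰ - M) κ`. Since `H` and `H⁰`
are both monic, the second term involves `e` only through its past, so it is orthogonal to `e(t)`,
and `V(θ)` is the constant `tr (Q Λ)` plus the asymptotic `Q`-power of `H⁻¹ (M⁰ - M) κ`. This excess
is nonnegative, vanishes at `θ₀`, and vanishes at `θ` only if every row of `(M⁰ - M) κ` has zero
asymptotic power, because `Q` is definite and `H` is invertible among stable filters. In row `j` the
difference of the transfer functions acts on `κ^[j]` only; its asymptotic power is the integral of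
the quadratic form of the spectral density at its frequency response, which therefore vanishes
almost everywhere, and so do its Fourier coefficients, the impulse response.
-/

noncomputable section

namespace PredErr

open scoped PowerSeries BoundedContinuousFunction RealInnerProductSpace

/-! ### The Wiener algebra -/

section Wiener

variable {𝕜 : Type*} [NormedField 𝕜]

variable (𝕜) in
/-- The Wiener algebra of power series with absolutely summable coefficients: the expansions in
`q⁻¹` of stable transfer functions lie in it, and it acts on bounded signals by convolution. -/
def wiener : Subalgebra 𝕜 𝕜⟦X⟧ where
  carrier := {f | Summable fun k => ‖PowerSeries.coeff k f‖}
  mul_mem' hf hg := by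
    simpa only [Set.mem_ofPred_eq, PowerSeries.coeff_mul] using
      summable_norm_sum_mul_antidiagonal_of_summable_norm hf hg
  add_mem' hf hg := (Summable.add hf hg).of_nonneg_of_le (fun _ => norm_nonneg _) fun k => by
    simpa only [map_add] using norm_add_le _ _
  algebraMap_mem' r := summable_of_ne_finset_zero (s := {0}) fun k hk => by
    simp [PowerSeries.coeff_C, Finset.notMem_singleton.1 hk]

theorem mem_wiener_iff {f : 𝕜⟦X⟧} :
    f ∈ wiener 𝕜 ↔ Summable fun k => ‖PowerSeries.coeff k f‖ := Iff.rfl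

theorem coe_polynomial_mem_wiener (p : Polynomial 𝕜) : (p : 𝕜⟦X⟧) ∈ wiener 𝕜 :=
  mem_wiener_iff.2 <| summable_of_ne_finset_zero (s := p.support) fun k hk => by
    simp [Polynomial.notMem_support_iff.1 hk]

theorem reverse_X_sub_C (z : 𝕜) :
    (Polynomial.X - Polynomial.C z).reverse = 1 - Polynomial.C z * Polynomial.X := by
  have hX : Polynomial.reflect 1 (Polynomial.X : Polynomial 𝕜) = 1 := by simp
  rw [Polynomial.reverse, Polynomial.natDegree_X_sub_C, Polynomial.reflect_sub, hX,
    Polynomial.reflect_C, pow_one]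

theorem inv_reverse_X_sub_C (z : 𝕜) :
    ((Polynomial.X - Polynomial.C z).reverse : 𝕜⟦X⟧)⁻¹ = PowerSeries.mk fun k => z ^ k := by
  have hrev : ((Polynomial.X - Polynomial.C z).reverse : 𝕜⟦X⟧) =
      PowerSeries.rescale z (1 - PowerSeries.X) := by
    simp [reverse_X_sub_C, PowerSeries.rescale_X]
  have hgeom := congrArg (PowerSeries.rescale z) (PowerSeries.mk_one_mul_one_sub_eq_one 𝕜)
  rw [map_mul, map_one, PowerSeries.rescale_mk] at hgeom
  rw [hrev, PowerSeries.inv_eq_iff_mul_eq_one (by simp)]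
  simpa only [Pi.one_apply, mul_one] using hgeom

theorem inv_reverse_prod_X_sub_C_mem_wiener (s : Multiset 𝕜) (hs : ∀ z ∈ s, ‖z‖ < 1) :
    ((s.map fun z => Polynomial.X - Polynomial.C z).prod.reverse : 𝕜⟦X⟧)⁻¹ ∈ wiener 𝕜 := by
  induction s using Multiset.induction_on with
  | empty =>
    have hrev : (1 : Polynomial 𝕜).reverse = 1 := by simpa using Polynomial.reverse_C (1 : 𝕜)
    simp [hrev]
  | cons z s ih =>
    have hz : ((Polynomial.X - Polynomial.C z).reverse : 𝕜⟦X⟧)⁻¹ ∈ wiener 𝕜 := by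
      rw [inv_reverse_X_sub_C, mem_wiener_iff]
      simpa only [PowerSeries.coeff_mk, norm_pow] using
        summable_geometric_of_lt_one (norm_nonneg z) (hs z (Multiset.mem_cons_self z s))
    rw [Multiset.map_cons, Multiset.prod_cons, Polynomial.reverse_mul_of_domain,
      Polynomial.coe_mul, PowerSeries.mul_inv_rev]
    exact mul_mem (ih fun w hw => hs w (Multiset.mem_cons_of_mem hw)) hz

theorem inv_reverse_mem_wiener_of_splits {D : Polynomial 𝕜} (hD : D.Splits)
    (hroots : ∀ z ∈ D.roots, ‖z‖ < 1) : (D.reverse : 𝕜⟦X⟧)⁻¹ ∈ wiener 𝕜 := by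
  rw [hD.eq_prod_roots, Polynomial.reverse_mul_of_domain, Polynomial.reverse_C,
    Polynomial.coe_mul, Polynomial.coe_C, PowerSeries.mul_inv_rev, PowerSeries.C_inv,
    ← Polynomial.coe_C]
  exact mul_mem (inv_reverse_prod_X_sub_C_mem_wiener D.roots hroots) (coe_polynomial_mem_wiener _)

theorem map_mem_wiener_iff {𝕜' : Type*} [NormedField 𝕜'] [NormedAlgebra 𝕜 𝕜'] {f : 𝕜⟦X⟧} :
    PowerSeries.map (algebraMap 𝕜 𝕜') f ∈ wiener 𝕜' ↔ f ∈ wiener 𝕜 := by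
  simp only [mem_wiener_iff, PowerSeries.coeff_map, norm_algebraMap']

theorem constantCoeff_reverse_ne_zero {D : Polynomial 𝕜} (hD : D ≠ 0) :
    PowerSeries.constantCoeff (D.reverse : 𝕜⟦X⟧) ≠ 0 := by
  rwa [← PowerSeries.coeff_zero_eq_constantCoeff_apply, Polynomial.coeff_coe,
    Polynomial.coeff_zero_reverse, Polynomial.leadingCoeff_ne_zero]

end Wiener

theorem map_coe_reverse (D : Polynomial ℝ) :
    PowerSeries.map (algebraMap ℝ ℂ) (D.reverse : ℝ⟦X⟧) =
      ((D.map (algebraMap ℝ ℂ)).reverse : ℂ⟦X⟧) := by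
  rw [← Polynomial.polynomial_map_coe, Polynomial.reverse, Polynomial.reverse,
    Polynomial.reflect_map, Polynomial.natDegree_map]

theorem inv_reverse_mem_wiener {D : Polynomial ℝ} (hD : D ≠ 0)
    (hroots : ∀ z : ℂ, 1 ≤ ‖z‖ → Polynomial.aeval z D ≠ 0) :
    (D.reverse : ℝ⟦X⟧)⁻¹ ∈ wiener ℝ := by
  set D' := D.map (algebraMap ℝ ℂ)
  have hD' : D' ≠ 0 := (Polynomial.map_ne_zero_iff (algebraMap ℝ ℂ).injective).2 hD
  have hmem : (D'.reverse : ℂ⟦X⟧)⁻¹ ∈ wiener ℂ :=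
    inv_reverse_mem_wiener_of_splits (IsAlgClosed.splits D') fun z hz => by
      by_contra! hz1
      refine hroots z hz1 ?_
      rw [← Polynomial.eval_map_algebraMap]
      exact (Polynomial.mem_roots hD').1 hz
  have hinv : (D'.reverse : ℂ⟦X⟧)⁻¹ = PowerSeries.map (algebraMap ℝ ℂ) (D.reverse : ℝ⟦X⟧)⁻¹ := by
    rw [PowerSeries.inv_eq_iff_mul_eq_one (constantCoeff_reverse_ne_zero hD'), ← map_coe_reverse,
      ← map_mul, PowerSeries.inv_mul_cancel _ (constantCoeff_reverse_ne_zero hD), map_one]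
  rwa [hinv, map_mem_wiener_iff] at hmem

/-! ### Expansions of transfer functions -/

theorem eval₂_single_one {R : Type*} [CommRing R] (p : Polynomial R) :
    p.eval₂ (HahnSeries.C : R →+* LaurentSeries R) (HahnSeries.single (1 : ℤ) (1 : R)) =
      HahnSeries.ofPowerSeries ℤ R (p : R⟦X⟧) := by
  have h : Polynomial.eval₂RingHom (HahnSeries.C : R →+* LaurentSeries R)
      (HahnSeries.single (1 : ℤ) (1 : R)) =
      (HahnSeries.ofPowerSeries ℤ R).comp Polynomial.coeToPowerSeries.ringHom := by
    ext r <;> simp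
  exact congrArg (fun φ => φ p) h

theorem eval₂_single_neg_one {R : Type*} [CommRing R] {N : ℕ} {p : Polynomial R}
    (hp : p.natDegree ≤ N) :
    p.eval₂ (HahnSeries.C : R →+* LaurentSeries R) (HahnSeries.single (-1 : ℤ) (1 : R)) =
      HahnSeries.ofPowerSeries ℤ R (p.reflect N : R⟦X⟧) *
        HahnSeries.single (-1 : ℤ) (1 : R) ^ N := by
  let _ : Invertible (HahnSeries.single (-1 : ℤ) (1 : R)) :=
    ⟨HahnSeries.single (1 : ℤ) (1 : R), by simp, by simp⟩
  rw [← Polynomial.eval₂_reflect_mul_pow _ _ N p hp, ← eval₂_single_one]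
  rfl

theorem single_neg_one_pow_ne_zero {K : Type*} [Field K] (N : ℕ) :
    HahnSeries.single (-1 : ℤ) (1 : K) ^ N ≠ 0 :=
  pow_ne_zero N (by simp)

theorem eval₂_single_neg_one_injective {K : Type*} [Field K] : Function.Injective
    (Polynomial.eval₂RingHom (HahnSeries.C : K →+* LaurentSeries K)
      (HahnSeries.single (-1 : ℤ) (1 : K))) := by
  refine (injective_iff_map_eq_zero _).2 fun p hp => ?_
  rw [Polynomial.coe_eval₂RingHom, eval₂_single_neg_one le_rfl, mul_eq_zero,
    or_iff_left (single_neg_one_pow_ne_zero _)] at hp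
  have hrev := HahnSeries.ofPowerSeries_injective (hp.trans (map_zero _).symm)
  rwa [← Polynomial.reverse, Polynomial.coe_eq_zero_iff, Polynomial.reverse_eq_zero] at hrev

/-- The expansion at infinity as a homomorphism of fields. -/
def expansionHom : RatFunc ℝ →+* LaurentSeries ℝ :=
  RatFunc.liftRingHom _
    (nonZeroDivisors_le_comap_nonZeroDivisors_of_injective _ eval₂_single_neg_one_injective)

theorem expansionHom_apply (F : RatFunc ℝ) : expansionHom F = expansion F := by
  rw [expansionHom, RatFunc.liftRingHom_apply]
  rfl

theorem filt_zero {Ω α β : Type*} [Fintype β] (s : ℤ → Ω → β → ℝ) :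
    filt (0 : Matrix α β (RatFunc ℝ)) s = 0 := by
  funext t ω a
  simp [filt, impulse, ← expansionHom_apply]

/-- The inclusion of the Wiener algebra into the field of Laurent series in `q⁻¹`. -/
def wienerToLaurent : wiener ℝ →+* LaurentSeries ℝ :=
  (HahnSeries.ofPowerSeries ℤ ℝ).comp (wiener ℝ).val.toRingHom

theorem wienerToLaurent_apply (f : wiener ℝ) :
    wienerToLaurent f = HahnSeries.ofPowerSeries ℤ ℝ (f : ℝ⟦X⟧) := rfl

theorem wienerToLaurent_injective : Function.Injective wienerToLaurent :=
  HahnSeries.ofPowerSeries_injective.comp Subtype.val_injective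

theorem IsStable.exists_wienerToLaurent_eq {F : RatFunc ℝ} (hF : IsStable F) :
    ∃ f : wiener ℝ, wienerToLaurent f = expansionHom F := by
  refine ⟨⟨_, mul_mem (coe_polynomial_mem_wiener (F.num.reflect F.denom.natDegree))
    (inv_reverse_mem_wiener F.denom_ne_zero hF.2)⟩, ?_⟩
  have hden := congrArg (HahnSeries.ofPowerSeries ℤ ℝ)
    (PowerSeries.inv_mul_cancel _ (constantCoeff_reverse_ne_zero F.denom_ne_zero))
  rw [map_mul, map_one] at hden
  rw [wienerToLaurent_apply, expansionHom_apply, expansion, RatFunc.eval,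
    eval₂_single_neg_one hF.1, eval₂_single_neg_one le_rfl,
    mul_div_mul_right _ _ (single_neg_one_pow_ne_zero _), map_mul, ← Polynomial.reverse,
    eq_div_iff (right_ne_zero_of_mul_eq_one hden), mul_assoc, hden, mul_one]

/-- The entries of `f`, in the Wiener algebra, are the expansions in `q⁻¹` of the entries of the
transfer matrix `F`. -/
def IsExpansion {α β : Type*} (f : Matrix α β (wiener ℝ)) (F : Matrix α β (RatFunc ℝ)) : Prop :=
  f.map wienerToLaurent = F.map expansionHom

theorem IsStableMatrix.exists_isExpansion {α β : Type*} {F : Matrix α β (RatFunc ℝ)}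
    (hF : IsStableMatrix F) : ∃ f, IsExpansion f F := by
  choose f hf using fun a b => (hF a b).exists_wienerToLaurent_eq
  exact ⟨Matrix.of f, Matrix.ext hf⟩

theorem IsStableMatrix.fromCols {α β γ : Type*} {F : Matrix α β (RatFunc ℝ)}
    {G : Matrix α γ (RatFunc ℝ)} (hF : IsStableMatrix F) (hG : IsStableMatrix G) :
    IsStableMatrix (Matrix.fromCols F G) := by
  rintro a (b | c)
  exacts [hF a b, hG a c]

theorem isExpansion_one {α : Type*} [DecidableEq α] :
    IsExpansion (1 : Matrix α α (wiener ℝ)) 1 := by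
  simp only [IsExpansion, map_zero, map_one, Matrix.map_one]

namespace IsExpansion

variable {α β γ : Type*} {f f' : Matrix α β (wiener ℝ)} {F F' : Matrix α β (RatFunc ℝ)}

theorem impulse_eq (hf : IsExpansion f F) (a : α) (b : β) (k : ℕ) :
    impulse (F a b) k = PowerSeries.coeff k (f a b : ℝ⟦X⟧) := by
  have hab : wienerToLaurent (f a b) = expansionHom (F a b) := congrFun₂ hf a b
  rw [impulse, ← expansionHom_apply, ← hab, wienerToLaurent_apply,
    LaurentSeries.coeff_coe_powerSeries]

theorem sub (hf : IsExpansion f F) (hf' : IsExpansion f' F') :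
    IsExpansion (f - f') (F - F') := by
  rw [IsExpansion, Matrix.map_sub _ (map_sub _), Matrix.map_sub _ (map_sub _), hf, hf']

theorem mul [Fintype β] {g : Matrix β γ (wiener ℝ)} {G : Matrix β γ (RatFunc ℝ)}
    (hf : IsExpansion f F) (hg : IsExpansion g G) : IsExpansion (f * g) (F * G) := by
  rw [IsExpansion, Matrix.map_mul, Matrix.map_mul, hf, hg]

theorem fromCols {g : Matrix α γ (wiener ℝ)} {G : Matrix α γ (RatFunc ℝ)}
    (hf : IsExpansion f F) (hg : IsExpansion g G) :
    IsExpansion (Matrix.fromCols f g) (Matrix.fromCols F G) := by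
  ext1 a (b | c)
  exacts [congrFun₂ hf a b, congrFun₂ hg a c]

theorem unique (hf : IsExpansion f F) (hf' : IsExpansion f' F) : f = f' :=
  Matrix.map_injective wienerToLaurent_injective (hf.trans hf'.symm)

theorem eq_zero_iff (hf : IsExpansion f F) (a : α) (b : β) : f a b = 0 ↔ F a b = 0 := by
  have hab : wienerToLaurent (f a b) = expansionHom (F a b) := congrFun₂ hf a b
  rw [← map_eq_zero_iff _ wienerToLaurent_injective, hab, map_eq_zero]

end IsExpansion

theorem IsNoiseModel.exists_isExpansion_inv {p : ℕ} {H : Matrix (Fin p) (Fin p) (RatFunc ℝ)}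
    (hH : IsNoiseModel H) :
    ∃ h hi, IsExpansion h H ∧ IsExpansion hi H⁻¹ ∧ hi * h = 1 := by
  obtain ⟨h, hh⟩ := hH.stable.exists_isExpansion
  obtain ⟨hi, hhi⟩ := hH.stable_inv.exists_isExpansion
  refine ⟨h, hi, hh, hhi, (hhi.mul hh).unique ?_⟩
  rw [Matrix.nonsing_inv_mul H hH.invertible]
  exact isExpansion_one

/-! ### Matrices acting on vectors of module elements -/

/-- The product of a matrix over `R` and a vector with entries in an `R`-module. -/
def matSMul {R V α β : Type*} [Fintype β] [SMul R V] [AddCommMonoid V] (F : Matrix α β R)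
    (x : β → V) : α → V :=
  fun a => ∑ b, F a b • x b

local notation:73 F:74 "•ᵥ" x:73 => matSMul F x

section MatSMul

variable {R V α β γ : Type*} [Fintype β] [Fintype γ]

theorem matSMul_apply [SMul R V] [AddCommMonoid V] (F : Matrix α β R) (x : β → V) (a : α) :
    (F •ᵥ x) a = ∑ b, F a b • x b := rfl

variable [Ring R] [AddCommGroup V] [Module R V]

theorem one_matSMul [DecidableEq β] (x : β → V) : (1 : Matrix β β R) •ᵥ x = x := by
  funext a
  simp [matSMul_apply, Matrix.one_apply, ite_smul]

theorem mul_matSMul (F : Matrix α β R) (F' : Matrix β γ R) (x : γ → V) :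
    (F * F') •ᵥ x = F •ᵥ F' •ᵥ x := by
  funext a
  simp only [matSMul_apply, Matrix.mul_apply, Finset.sum_smul, Finset.smul_sum, mul_smul]
  exact Finset.sum_comm

theorem sub_matSMul (F F' : Matrix α β R) (x : β → V) :
    (F - F') •ᵥ x = F •ᵥ x - F' •ᵥ x := by
  funext a
  simp only [matSMul_apply, Matrix.sub_apply, sub_smul, Finset.sum_sub_distrib, Pi.sub_apply]

theorem matSMul_add (F : Matrix α β R) (x x' : β → V) :
    F •ᵥ (x + x') = F •ᵥ x + F •ᵥ x' := by
  funext a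
  simp only [matSMul_apply, Pi.add_apply, smul_add, Finset.sum_add_distrib]

theorem matSMul_sub (F : Matrix α β R) (x x' : β → V) :
    F •ᵥ (x - x') = F •ᵥ x - F •ᵥ x' := by
  funext a
  simp only [matSMul_apply, Pi.sub_apply, smul_sub, Finset.sum_sub_distrib]

theorem fromCols_matSMul (F : Matrix α β R) (F' : Matrix α γ R) (x : β ⊕ γ → V) :
    Matrix.fromCols F F' •ᵥ x = F •ᵥ (x ∘ Sum.inl) + F' •ᵥ (x ∘ Sum.inr) := by
  funext a
  simp [matSMul_apply]

theorem matSMul_mem {W : Submodule R V} (F : Matrix α β R) {x : β → V} (hx : ∀ b, x b ∈ W)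
    (a : α) : (F •ᵥ x) a ∈ W :=
  sum_mem fun b _ => W.smul_mem _ (hx b)

theorem forall_matSMul_mem_iff [DecidableEq β] {W : Submodule R V} {F F' : Matrix β β R}
    (hF : F' * F = 1) {x : β → V} : (∀ b, (F •ᵥ x) b ∈ W) ↔ ∀ b, x b ∈ W := by
  refine ⟨fun hx b => ?_, matSMul_mem F⟩
  rw [← one_matSMul (R := R) x, ← hF, mul_matSMul]
  exact matSMul_mem F' hx b

theorem sub_predictor_eq [DecidableEq β] {g₀ g : Matrix β γ R} {h₀ h h' : Matrix β β R}
    (hh : h' * h = 1) (x : γ ⊕ β → V) {y : β → V} (hy : y = matSMul (Matrix.fromCols g₀ h₀) x) :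
    y - ((1 - h') •ᵥ y + (h' * g) •ᵥ (x ∘ Sum.inl)) =
      x ∘ Sum.inr + (h' * (Matrix.fromCols g₀ h₀ - Matrix.fromCols g h)) •ᵥ x := by
  have hmodel : h' •ᵥ Matrix.fromCols g h •ᵥ x = (h' * g) •ᵥ (x ∘ Sum.inl) + x ∘ Sum.inr := by
    rw [fromCols_matSMul, matSMul_add, ← mul_matSMul, ← mul_matSMul, hh, one_matSMul]
  rw [sub_matSMul, one_matSMul, mul_matSMul h' (_ - _), sub_matSMul, ← hy, matSMul_sub,
    hmodel]
  abel

end MatSMul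

/-! ### The action of the Wiener algebra on bounded signals -/

section Filters

variable {E : Type*} [NormedAddCommGroup E] [NormedSpace ℝ E]

/-- The delay by `k` time units. -/
def delay (k : ℤ) : (ℤ →ᵇ E) →L[ℝ] (ℤ →ᵇ E) :=
  BoundedContinuousFunction.compContinuousCLM E ℝ
    ⟨fun t : ℤ => t - k, continuous_of_discreteTopology⟩

@[simp]
theorem delay_apply (k : ℤ) (x : ℤ →ᵇ E) (t : ℤ) : delay k x t = x (t - k) := rfl

theorem norm_delay_le (k : ℤ) : ‖(delay k : (ℤ →ᵇ E) →L[ℝ] (ℤ →ᵇ E))‖ ≤ 1 :=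
  BoundedContinuousFunction.norm_compContinuousCLM_le_one _

theorem norm_delay_apply_le (k : ℤ) (x : ℤ →ᵇ E) : ‖delay k x‖ ≤ ‖x‖ :=
  BoundedContinuousFunction.norm_compContinuous_le x _

theorem delay_delay (k l : ℤ) (x : ℤ →ᵇ E) : delay k (delay l x) = delay (k + l) x := by
  ext t
  simp [sub_sub]

theorem delay_mul_delay (k l : ℤ) :
    (delay k * delay l : (ℤ →ᵇ E) →L[ℝ] (ℤ →ᵇ E)) = delay (k + l) :=
  ContinuousLinearMap.ext (delay_delay k l)

@[simp]
theorem delay_zero : (delay 0 : (ℤ →ᵇ E) →L[ℝ] (ℤ →ᵇ E)) = 1 := by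
  ext
  simp

theorem summable_norm_coeff_smul_delay (f : wiener ℝ) :
    Summable fun k : ℕ =>
      ‖PowerSeries.coeff k (f : ℝ⟦X⟧) • (delay k : (ℤ →ᵇ E) →L[ℝ] (ℤ →ᵇ E))‖ :=
  (mem_wiener_iff.1 f.2).of_nonneg_of_le (fun _ => norm_nonneg _) fun k => by
    rw [norm_smul]
    exact mul_le_of_le_one_right (norm_nonneg _) (norm_delay_le _)

/-- The filter with impulse response `f`, as an operator on bounded signals. -/
def filterOp (f : wiener ℝ) : (ℤ →ᵇ E) →L[ℝ] (ℤ →ᵇ E) :=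
  ∑' k : ℕ, PowerSeries.coeff k (f : ℝ⟦X⟧) • delay (k : ℤ)

theorem filterOp_one : (filterOp 1 : (ℤ →ᵇ E) →L[ℝ] (ℤ →ᵇ E)) = 1 := by
  rw [filterOp, tsum_eq_single 0 fun k hk => by simp [PowerSeries.coeff_one, hk]]
  simp

variable [CompleteSpace E]

theorem summable_coeff_smul_delay (f : wiener ℝ) :
    Summable fun k : ℕ =>
      PowerSeries.coeff k (f : ℝ⟦X⟧) • (delay k : (ℤ →ᵇ E) →L[ℝ] (ℤ →ᵇ E)) :=
  .of_norm (summable_norm_coeff_smul_delay f)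

theorem filterOp_add (f g : wiener ℝ) :
    (filterOp (f + g) : (ℤ →ᵇ E) →L[ℝ] (ℤ →ᵇ E)) = filterOp f + filterOp g := by
  simp only [filterOp, Subalgebra.coe_add, map_add, add_smul]
  exact (summable_coeff_smul_delay f).tsum_add (summable_coeff_smul_delay g)

theorem filterOp_smul (r : ℝ) (f : wiener ℝ) :
    (filterOp (r • f) : (ℤ →ᵇ E) →L[ℝ] (ℤ →ᵇ E)) = r • filterOp f := by
  simp only [filterOp, Subalgebra.coe_smul, map_smul, smul_assoc]
  exact (summable_coeff_smul_delay f).tsum_const_smul r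

theorem filterOp_mul (f g : wiener ℝ) :
    (filterOp (f * g) : (ℤ →ᵇ E) →L[ℝ] (ℤ →ᵇ E)) = filterOp f * filterOp g := by
  have hprod := tsum_mul_tsum_eq_tsum_sum_antidiagonal_of_summable_norm
    (summable_norm_coeff_smul_delay (E := E) f) (summable_norm_coeff_smul_delay (E := E) g)
  refine Eq.trans (tsum_congr fun k => ?_) hprod.symm
  rw [Subalgebra.coe_mul, PowerSeries.coeff_mul, Finset.sum_smul]
  refine Finset.sum_congr rfl fun ij hij => ?_
  rw [smul_mul_smul_comm, delay_mul_delay, ← Nat.cast_add,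
    Finset.HasAntidiagonal.mem_antidiagonal.1 hij]

variable (E) in
/-- Filtering as a representation of the Wiener algebra on bounded signals. -/
def filterHom : wiener ℝ →ₐ[ℝ] ((ℤ →ᵇ E) →L[ℝ] (ℤ →ᵇ E)) :=
  AlgHom.ofLinearMap ⟨⟨filterOp, filterOp_add⟩, filterOp_smul⟩ filterOp_one filterOp_mul

/-- A power series in the Wiener algebra acts on bounded signals as the filter with these
coefficients as impulse response. -/
instance filterModule : Module (wiener ℝ) (ℤ →ᵇ E) :=
  Module.compHom _ (filterHom E).toRingHom

theorem wiener_smul_eq (f : wiener ℝ) (x : ℤ →ᵇ E) : f • x = filterOp f x := rfl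

instance filter_isScalarTower : IsScalarTower ℝ (wiener ℝ) (ℤ →ᵇ E) where
  smul_assoc r f x := by
    rw [wiener_smul_eq, filterOp_smul]
    rfl

theorem hasSum_wiener_smul (f : wiener ℝ) (x : ℤ →ᵇ E) :
    HasSum (fun k : ℕ => PowerSeries.coeff k (f : ℝ⟦X⟧) • delay (k : ℤ) x) (f • x) :=
  (summable_coeff_smul_delay f).hasSum.mapL (ContinuousLinearMap.apply ℝ (ℤ →ᵇ E) x)

theorem wiener_smul_apply (f : wiener ℝ) (x : ℤ →ᵇ E) (t : ℤ) :
    (f • x) t = ∑' k : ℕ, PowerSeries.coeff k (f : ℝ⟦X⟧) • x (t - k) :=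
  ((hasSum_wiener_smul f x).mapL
    (BoundedContinuousFunction.evalCLM ℝ t : (ℤ →ᵇ E) →L[ℝ] E)).tsum_eq.symm

end Filters

/-! ### Time averages of inner products -/

section Averages

variable {E : Type*} [NormedAddCommGroup E] [InnerProductSpace ℝ E]

/-- The average over `1 ≤ t ≤ N` of `⟪x t, y t⟫`, as a bilinear form in the signals `x`, `y`. -/
def avg (N : ℕ) : (ℤ →ᵇ E) →L[ℝ] (ℤ →ᵇ E) →L[ℝ] ℝ :=
  (N : ℝ)⁻¹ • ∑ t ∈ Finset.Icc 1 N, (innerSL ℝ).bilinearComp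
    (BoundedContinuousFunction.evalCLM ℝ (t : ℤ)) (BoundedContinuousFunction.evalCLM ℝ (t : ℤ))

theorem avg_apply (N : ℕ) (x y : ℤ →ᵇ E) :
    avg N x y = (N : ℝ)⁻¹ * ∑ t ∈ Finset.Icc 1 N, ⟪x (t : ℤ), y (t : ℤ)⟫ := by
  simp [avg]

theorem avg_comm (N : ℕ) (x y : ℤ →ᵇ E) : avg N x y = avg N y x := by
  simp only [avg_apply, real_inner_comm]

theorem abs_inner_apply_le (x y : ℤ →ᵇ E) (t : ℤ) : |⟪x t, y t⟫| ≤ ‖x‖ * ‖y‖ :=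
  (abs_real_inner_le_norm _ _).trans
    (mul_le_mul (x.norm_coe_le_norm t) (y.norm_coe_le_norm t) (norm_nonneg _) (norm_nonneg _))

theorem abs_avg_le (N : ℕ) (x y : ℤ →ᵇ E) : |avg N x y| ≤ ‖x‖ * ‖y‖ := by
  have hsum : |∑ t ∈ Finset.Icc 1 N, ⟪x (t : ℤ), y (t : ℤ)⟫| ≤ N * (‖x‖ * ‖y‖) :=
    (Finset.abs_sum_le_sum_abs _ _).trans <|
      (Finset.sum_le_sum fun (t : ℕ) _ => abs_inner_apply_le x y t).trans (by simp)
  rw [avg_apply, abs_mul, abs_of_nonneg (by positivity : (0 : ℝ) ≤ (N : ℝ)⁻¹)]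
  exact inv_mul_le_of_le_mul₀ N.cast_nonneg (by positivity) hsum

theorem avg_self_nonneg (N : ℕ) (x : ℤ →ᵇ E) : 0 ≤ avg N x x := by
  rw [avg_apply]
  exact mul_nonneg (by positivity) (Finset.sum_nonneg fun t _ => real_inner_self_nonneg)

theorem avg_sq_le (N : ℕ) (x y : ℤ →ᵇ E) : avg N x y ^ 2 ≤ avg N x x * avg N y y :=
  LinearMap.BilinForm.apply_sq_le_of_symm (avg N).toBilinForm (avg_self_nonneg N)
    ⟨fun x y => avg_comm N x y⟩ x y

theorem sum_inner_delay_one (x y : ℤ →ᵇ E) (N : ℕ) :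
    ∑ t ∈ Finset.Icc 1 N, ⟪delay 1 x t, delay 1 y t⟫ =
      ∑ t ∈ Finset.Icc 1 N, ⟪x (t : ℤ), y (t : ℤ)⟫ + (⟪x 0, y 0⟫ - ⟪x (N : ℤ), y (N : ℤ)⟫) := by
  induction N with
  | zero => simp
  | succ N ih =>
    rw [Finset.sum_Icc_succ_top (by omega), Finset.sum_Icc_succ_top (by omega), ih]
    simp only [delay_apply, Nat.cast_add, Nat.cast_one, add_sub_cancel_right]
    ring

theorem tendsto_avg_delay_one_sub (x y : ℤ →ᵇ E) :
    Tendsto (fun N => avg N (delay 1 x) (delay 1 y) - avg N x y) atTop (𝓝 0) := by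
  refine squeeze_zero_norm (a := fun N : ℕ => (N : ℝ)⁻¹ * (2 * (‖x‖ * ‖y‖))) (fun N => ?_) ?_
  · rw [avg_apply, avg_apply, ← mul_sub, sum_inner_delay_one, add_sub_cancel_left,
      Real.norm_eq_abs, abs_mul, abs_of_nonneg (by positivity : (0 : ℝ) ≤ (N : ℝ)⁻¹)]
    refine mul_le_mul_of_nonneg_left ((abs_sub _ _).trans ?_) (by positivity)
    linarith [abs_inner_apply_le x y 0, abs_inner_apply_le x y N]
  · simpa only [zero_mul] using
      (tendsto_inv_atTop_nhds_zero_nat (𝕜 := ℝ)).mul_const (2 * (‖x‖ * ‖y‖))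

theorem tendsto_avg_delay_sub (k : ℤ) (x y : ℤ →ᵇ E) :
    Tendsto (fun N => avg N (delay k x) (delay k y) - avg N x y) atTop (𝓝 0) := by
  induction k using Int.induction_on generalizing x y with
  | zero => simp
  | succ k ih =>
    simpa [delay_delay, add_comm (1 : ℤ)] using
      (tendsto_avg_delay_one_sub (delay k x) (delay k y)).add (ih x y)
  | pred k ih =>
    simpa [delay_delay] using
      (ih x y).sub (tendsto_avg_delay_one_sub (delay (-k - 1) x) (delay (-k - 1) y))

theorem tendsto_avg_delay {x y : ℤ →ᵇ E} {L : ℝ} (k : ℤ)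
    (h : Tendsto (fun N => avg N x y) atTop (𝓝 L)) :
    Tendsto (fun N => avg N (delay k x) (delay k y)) atTop (𝓝 L) := by
  simpa only [sub_add_cancel, zero_add] using (tendsto_avg_delay_sub k x y).add h

theorem tendsto_avg_of_tendsto_avg_self {x : ℤ →ᵇ E}
    (hx : Tendsto (fun N => avg N x x) atTop (𝓝 0)) (z : ℤ →ᵇ E) :
    Tendsto (fun N => avg N x z) atTop (𝓝 0) := by
  have hsq : Tendsto (fun N => avg N x z ^ 2) atTop (𝓝 0) := by
    refine squeeze_zero (fun N => sq_nonneg _) (fun N => ?_)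
      (by simpa only [zero_mul] using hx.mul_const (‖z‖ * ‖z‖))
    exact (avg_sq_le N x z).trans
      (mul_le_mul_of_nonneg_left ((le_abs_self _).trans (abs_avg_le N z z)) (avg_self_nonneg N x))
  have habs := (Real.continuous_sqrt.tendsto 0).comp hsq
  simp only [Function.comp_def, Real.sqrt_sq_eq_abs, Real.sqrt_zero] at habs
  exact (tendsto_zero_iff_abs_tendsto_zero _).2 habs

section Filtered

variable [CompleteSpace E]

theorem tendsto_avg_smul (f : wiener ℝ) {x y : ℤ →ᵇ E} {r : ℕ → ℝ}
    (h : ∀ k : ℕ, Tendsto (fun N => avg N x (delay k y)) atTop (𝓝 (r k))) :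
    Tendsto (fun N => avg N x (f • y)) atTop
      (𝓝 (∑' k, PowerSeries.coeff k (f : ℝ⟦X⟧) * r k)) := by
  have havg : ∀ N, avg N x (f • y) = ∑' k : ℕ, PowerSeries.coeff k (f : ℝ⟦X⟧) *
      avg N x (delay k y) := fun N => by
    simpa only [map_smul, smul_eq_mul] using
      ((hasSum_wiener_smul f y).mapL (avg N x)).tsum_eq.symm
  simp only [havg]
  refine tendsto_tsum_of_dominated_convergence ((mem_wiener_iff.1 f.2).mul_right (‖x‖ * ‖y‖))
    (fun k => (h k).const_mul _) (Eventually.of_forall fun N k => ?_)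
  rw [norm_mul]
  refine mul_le_mul_of_nonneg_left ((abs_avg_le _ _ _).trans ?_) (norm_nonneg _)
  exact mul_le_mul_of_nonneg_left (norm_delay_apply_le _ y) (norm_nonneg _)

theorem tendsto_avg_smul_smul (f f' : wiener ℝ) {x y : ℤ →ᵇ E} {R : ℤ → ℝ}
    (h : ∀ τ : ℤ, Tendsto (fun N => avg N x (delay τ y)) atTop (𝓝 (R τ))) :
    Tendsto (fun N => avg N (f • x) (f' • y)) atTop
      (𝓝 (∑' l : ℕ, PowerSeries.coeff l (f' : ℝ⟦X⟧) *
        ∑' k : ℕ, PowerSeries.coeff k (f : ℝ⟦X⟧) * R (l - k))) := by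
  refine tendsto_avg_smul f' fun l => ?_
  simp only [avg_comm _ (f • x)]
  refine tendsto_avg_smul f fun k => ?_
  simp only [avg_comm _ (delay (l : ℤ) y)]
  simpa only [delay_delay, add_sub_cancel] using tendsto_avg_delay (k : ℤ) (h (l - k))

theorem tendsto_avg_matSMul_matSMul {α α' β β' : Type*} [Fintype β] [Fintype β']
    (F : Matrix α β (wiener ℝ)) (F' : Matrix α' β' (wiener ℝ)) {x : β → ℤ →ᵇ E}
    {y : β' → ℤ →ᵇ E} {R : ℤ → Matrix β β' ℝ}
    (h : ∀ τ b b', Tendsto (fun N => avg N (x b) (delay τ (y b'))) atTop (𝓝 (R τ b b')))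
    (a : α) (a' : α') :
    Tendsto (fun N => avg N ((F •ᵥ x) a) ((F' •ᵥ y) a')) atTop
      (𝓝 (∑ b, ∑ b', ∑' l : ℕ, PowerSeries.coeff l (F' a' b' : ℝ⟦X⟧) *
        ∑' k : ℕ, PowerSeries.coeff k (F a b : ℝ⟦X⟧) * R (l - k) b b')) := by
  simp only [matSMul_apply, map_sum, sum_apply]
  rw [Finset.sum_comm]
  exact tendsto_finsetSum _ fun b' _ => tendsto_finsetSum _ fun b _ =>
    tendsto_avg_smul_smul _ _ fun τ => h τ b b'

variable (E) in
/-- The signals of zero asymptotic power, which filters and sums preserve. -/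
def negligible : Submodule (wiener ℝ) (ℤ →ᵇ E) where
  carrier := {x | Tendsto (fun N => avg N x x) atTop (𝓝 0)}
  zero_mem' := by simp
  add_mem' {x y} hx hy := by
    have h := (tendsto_avg_of_tendsto_avg_self hx (x + y)).add
      (tendsto_avg_of_tendsto_avg_self hy (x + y))
    simp only [← add_apply, ← map_add, zero_add] at h
    exact h
  smul_mem' f x hx := by
    have h := tendsto_avg_smul_smul f f (R := fun _ => 0) fun τ =>
      tendsto_avg_of_tendsto_avg_self hx (delay τ x)
    simp only [mul_zero, tsum_zero] at h
    exact h

theorem mem_negligible_iff {x : ℤ →ᵇ E} :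
    x ∈ negligible E ↔ Tendsto (fun N => avg N x x) atTop (𝓝 0) := Iff.rfl

end Filtered

/-! ### Weighted time averages -/

section Weighted

variable {ι κ : Type*} [Fintype ι] [Fintype κ]

/-- The average over `1 ≤ t ≤ N` of the quadratic form with matrix `Q` at `x t`. -/
def weightedAvg (Q : Matrix ι ι ℝ) (N : ℕ) (x : ι → ℤ →ᵇ E) : ℝ :=
  ∑ a, avg N (x a) ((Q •ᵥ x) a)

theorem sum_avg_transpose_matSMul (C : Matrix κ ι ℝ) (N : ℕ) (x : ι → ℤ →ᵇ E)
    (z : κ → ℤ →ᵇ E) :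
    ∑ a, avg N (x a) ((C.transpose •ᵥ z) a) = ∑ k, avg N ((C •ᵥ x) k) (z k) := by
  simp only [matSMul_apply, map_sum, map_smul, sum_apply, smul_apply,
    Matrix.transpose_apply]
  exact Finset.sum_comm

theorem weightedAvg_transpose_mul_self (C : Matrix κ ι ℝ) (N : ℕ) (x : ι → ℤ →ᵇ E) :
    weightedAvg (C.transpose * C) N x = ∑ k, avg N ((C •ᵥ x) k) ((C •ᵥ x) k) := by
  rw [weightedAvg, mul_matSMul, sum_avg_transpose_matSMul]

theorem tendsto_weightedAvg (Q : Matrix ι ι ℝ) {x : ι → ℤ →ᵇ E} {R : Matrix ι ι ℝ}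
    (h : ∀ a b, Tendsto (fun N => avg N (x a) (x b)) atTop (𝓝 (R a b))) :
    Tendsto (fun N => weightedAvg Q N x) atTop (𝓝 (∑ a, ∑ b, Q a b * R a b)) := by
  simp only [weightedAvg, matSMul_apply, map_sum, map_smul, smul_eq_mul]
  exact tendsto_finsetSum _ fun a _ => tendsto_finsetSum _ fun b _ => (h a b).const_mul _

open scoped MatrixOrder in
theorem exists_isUnit_eq_transpose_mul_self [DecidableEq ι] {Q : Matrix ι ι ℝ} (hQ : Q.PosDef) :
    ∃ C : Matrix ι ι ℝ, IsUnit C ∧ Q = C.transpose * C := by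
  obtain ⟨C, hC, rfl⟩ := CStarAlgebra.isStrictlyPositive_iff_eq_star_mul_self.mp
    hQ.isStrictlyPositive
  refine ⟨C, hC, ?_⟩
  rw [Matrix.star_eq_conjTranspose, Matrix.conjTranspose_eq_transpose_of_trivial]

theorem weightedAvg_nonneg {Q : Matrix ι ι ℝ} (hQ : Q.PosDef) (N : ℕ) (x : ι → ℤ →ᵇ E) :
    0 ≤ weightedAvg Q N x := by
  classical
  obtain ⟨C, -, rfl⟩ := exists_isUnit_eq_transpose_mul_self hQ
  rw [weightedAvg_transpose_mul_self]
  exact Finset.sum_nonneg fun k _ => avg_self_nonneg N _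

theorem tendsto_weightedAvg_zero_iff [CompleteSpace E] {Q : Matrix ι ι ℝ} (hQ : Q.PosDef)
    {x : ι → ℤ →ᵇ E} :
    Tendsto (fun N => weightedAvg Q N x) atTop (𝓝 0) ↔ ∀ a, x a ∈ negligible E := by
  classical
  refine ⟨fun h => ?_, fun hx => ?_⟩
  · obtain ⟨C, hC, rfl⟩ := exists_isUnit_eq_transpose_mul_self hQ
    simp only [weightedAvg_transpose_mul_self] at h
    refine (forall_matSMul_mem_iff (W := (negligible E).restrictScalars ℝ)
      (Matrix.nonsing_inv_mul C ((Matrix.isUnit_iff_isUnit_det C).1 hC))).1 fun k => ?_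
    exact squeeze_zero (fun N => avg_self_nonneg N _)
      (fun N => Finset.single_le_sum (f := fun k => avg N ((C •ᵥ x) k) ((C •ᵥ x) k))
        (fun k _ => avg_self_nonneg N _) (Finset.mem_univ k)) h
  · simpa using tendsto_weightedAvg Q (R := 0)
      fun a b => tendsto_avg_of_tendsto_avg_self (mem_negligible_iff.1 (hx a)) (x b)

end Weighted

end Averages

/-! ### Frequency responses -/

section Frequency

/-- The trigonometric function `w ↦ exp (i w n)`, in the form used in `HasSpectralDensity`. -/
def character (n : ℤ) (w : ℝ) : ℂ := Complex.exp (Complex.I * w * n)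

theorem continuous_character (n : ℤ) : Continuous (character n) := by
  unfold character
  fun_prop

theorem norm_character (n : ℤ) (w : ℝ) : ‖character n w‖ = 1 := by
  rw [character, show Complex.I * w * n = ((w * n : ℝ) : ℂ) * Complex.I by push_cast; ring,
    Complex.norm_exp_ofReal_mul_I]

theorem conj_character (n : ℤ) (w : ℝ) : starRingEnd ℂ (character n w) = character (-n) w := by
  rw [character, character, ← Complex.exp_conj]
  simp

theorem character_mul_character (n n' : ℤ) (w : ℝ) :
    character n w * character n' w = character (n + n') w := by
  rw [character, character, character, ← Complex.exp_add, Int.cast_add, mul_add]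

theorem integral_character (n : ℤ) :
    ∫ w in (-Real.pi)..Real.pi, character n w = if n = 0 then 2 * (Real.pi : ℂ) else 0 := by
  unfold character
  split_ifs with hn
  · simp [hn, two_mul]
  · have hc : Complex.I * n ≠ 0 := mul_ne_zero Complex.I_ne_zero (Int.cast_ne_zero.2 hn)
    simp only [mul_right_comm Complex.I _ (n : ℂ)]
    rw [integral_exp_mul_complex hc, div_eq_zero_iff, sub_eq_zero]
    left
    rw [← Complex.exp_periodic.int_mul n (Complex.I * n * ((-Real.pi : ℝ) : ℂ))]
    congr 1
    push_cast
    ring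

/-- The frequency response `w ↦ ∑ₖ fₖ exp (-i w k)` of the filter with impulse response `f`. -/
def freqResponse (f : wiener ℝ) (w : ℝ) : ℂ :=
  ∑' k : ℕ, ((PowerSeries.coeff k (f : ℝ⟦X⟧) : ℝ) : ℂ) * character (-k) w

theorem continuous_freqResponse (f : wiener ℝ) : Continuous (freqResponse f) :=
  continuous_tsum (fun k => continuous_const.mul (continuous_character _)) (mem_wiener_iff.1 f.2)
    fun k w => by simp [norm_character]

theorem norm_freqResponse_le (f : wiener ℝ) (w : ℝ) :
    ‖freqResponse f w‖ ≤ ∑' k, ‖PowerSeries.coeff k (f : ℝ⟦X⟧)‖ :=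
  tsum_of_norm_bounded (mem_wiener_iff.1 f.2).hasSum fun k => by simp [norm_character]

variable {μ : Measure ℝ} {φ : ℝ → ℂ}

theorem integrable_mul_character (hφ : Integrable φ μ) (n : ℤ) :
    Integrable (fun w => φ w * character n w) μ :=
  hφ.mul_bdd (continuous_character n).aestronglyMeasurable
    (Eventually.of_forall fun w => (norm_character n w).le)

theorem integrable_mul_freqResponse (hφ : Integrable φ μ) (f : wiener ℝ) :
    Integrable (fun w => φ w * freqResponse f w) μ :=
  hφ.mul_bdd (continuous_freqResponse f).aestronglyMeasurable
    (Eventually.of_forall (norm_freqResponse_le f))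

theorem integrable_conj (hφ : Integrable φ μ) : Integrable (fun w => starRingEnd ℂ (φ w)) μ :=
  Complex.conjLIE.integrable_comp_iff.2 hφ

/-- The trigonometric moment `∫ φ(w) exp (i w n) dμ(w)`. -/
def trigMoment (μ : Measure ℝ) (φ : ℝ → ℂ) (n : ℤ) : ℂ :=
  ∫ w, φ w * character n w ∂μ

theorem conj_trigMoment (μ : Measure ℝ) (φ : ℝ → ℂ) (n : ℤ) :
    starRingEnd ℂ (trigMoment μ φ n) = trigMoment μ (fun w => starRingEnd ℂ (φ w)) (-n) := by
  rw [trigMoment, trigMoment, ← integral_conj]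
  simp only [map_mul, conj_character]

theorem hasSum_coeff_mul_trigMoment (hφ : Integrable φ μ) (f : wiener ℝ) (n : ℤ) :
    HasSum (fun k : ℕ => ((PowerSeries.coeff k (f : ℝ⟦X⟧) : ℝ) : ℂ) * trigMoment μ φ (n - k))
      (trigMoment μ (fun w => φ w * freqResponse f w) n) := by
  have hvalue : ∀ w, φ w * freqResponse f w * character n w =
      ∑' k : ℕ, ((PowerSeries.coeff k (f : ℝ⟦X⟧) : ℝ) : ℂ) * (φ w * character (n - k) w) :=
    fun w => by
      rw [mul_right_comm, freqResponse, ← tsum_mul_left]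
      refine tsum_congr fun k => ?_
      rw [sub_eq_add_neg, ← character_mul_character]
      ring
  have hnorm : ∀ k : ℕ, ∫ w, ‖((PowerSeries.coeff k (f : ℝ⟦X⟧) : ℝ) : ℂ) *
      (φ w * character (n - k) w)‖ ∂μ = ‖PowerSeries.coeff k (f : ℝ⟦X⟧)‖ * ∫ w, ‖φ w‖ ∂μ :=
    fun k => by simp only [norm_mul, norm_character, mul_one, integral_const_mul,
      Complex.norm_real]
  have h := hasSum_integral_of_summable_integral_norm
    (fun k : ℕ => (integrable_mul_character hφ (n - k)).const_mul
      ((PowerSeries.coeff k (f : ℝ⟦X⟧) : ℝ) : ℂ))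
    (by simpa only [hnorm] using (mem_wiener_iff.1 f.2).mul_right (∫ w, ‖φ w‖ ∂μ))
  simp only [integral_const_mul, ← hvalue] at h
  exact h

theorem hasSum_coeff_mul_trigMoment_conj (hφ : Integrable φ μ) (f : wiener ℝ) (n : ℤ) :
    HasSum (fun k : ℕ => ((PowerSeries.coeff k (f : ℝ⟦X⟧) : ℝ) : ℂ) * trigMoment μ φ (n + k))
      (trigMoment μ (fun w => φ w * starRingEnd ℂ (freqResponse f w)) n) := by
  have h := (hasSum_coeff_mul_trigMoment (integrable_conj hφ) f (-n)).star
  simpa only [← starRingEnd_apply, map_mul, Complex.conj_ofReal, conj_trigMoment,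
    Complex.conj_conj, neg_sub, sub_neg_eq_add, neg_neg, add_comm n] using h

theorem tsum_coeff_mul_tsum_coeff_mul (hφ : Integrable φ μ) (f f' : wiener ℝ) {R : ℤ → ℝ} {c : ℂ}
    (hR : ∀ τ : ℤ, (R τ : ℂ) = c * trigMoment μ φ τ) :
    ((∑' l : ℕ, PowerSeries.coeff l (f' : ℝ⟦X⟧) *
        ∑' k : ℕ, PowerSeries.coeff k (f : ℝ⟦X⟧) * R (l - k) : ℝ) : ℂ) =
      c * ∫ w, φ w * freqResponse f w * starRingEnd ℂ (freqResponse f' w) ∂μ := by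
  have hinner : ∀ l : ℕ, ((∑' k : ℕ, PowerSeries.coeff k (f : ℝ⟦X⟧) * R (l - k) : ℝ) : ℂ) =
      c * trigMoment μ (fun w => φ w * freqResponse f w) l := fun l => by
    rw [← (hasSum_coeff_mul_trigMoment hφ f l).tsum_eq, ← tsum_mul_left, Complex.ofReal_tsum]
    exact tsum_congr fun k => by rw [Complex.ofReal_mul, hR, mul_left_comm]
  have houter := hasSum_coeff_mul_trigMoment_conj (integrable_mul_freqResponse hφ f) f' 0
  simp only [zero_add, trigMoment, character, Int.cast_zero, mul_zero, Complex.exp_zero,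
    mul_one] at houter
  rw [← houter.tsum_eq, ← tsum_mul_left, Complex.ofReal_tsum]
  exact tsum_congr fun l => by
    rw [Complex.ofReal_mul, hinner, mul_left_comm, trigMoment]
    simp only [character]

theorem eq_zero_of_freqResponse_ae_eq_zero {f : wiener ℝ}
    (h0 : ∀ᵐ w ∂volume.restrict (Set.Ioc (-Real.pi) Real.pi), freqResponse f w = 0) : f = 0 := by
  have hmoment : ∀ n, trigMoment (volume.restrict (Set.Ioc (-Real.pi) Real.pi)) (fun _ => 1) n =
      if n = 0 then 2 * (Real.pi : ℂ) else 0 := fun n => by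
    rw [← integral_character, intervalIntegral.integral_of_le (by linarith [Real.pi_pos])]
    simp only [trigMoment, one_mul]
  refine Subtype.ext (PowerSeries.ext fun k => ?_)
  have hsum := hasSum_coeff_mul_trigMoment (integrable_const (1 : ℂ)) f k
    (μ := volume.restrict (Set.Ioc (-Real.pi) Real.pi))
  have hzero : trigMoment (volume.restrict (Set.Ioc (-Real.pi) Real.pi))
      (fun w => 1 * freqResponse f w) k = 0 :=
    integral_eq_zero_of_ae (h0.mono fun w hw => by simp [hw])
  simp only [hmoment, hzero, sub_eq_zero, Nat.cast_inj] at hsum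
  have hk := hsum.unique (hasSum_single k fun l hl => by simp [hl.symm])
  simpa [Real.pi_ne_zero] using hk.symm

theorem ae_eq_zero_of_integral_posDef {ι : Type*} [Fintype ι] {Φ : ℝ → Matrix ι ι ℂ}
    (hpos : ∀ᵐ w ∂μ, (Φ w).PosDef) {x : ℝ → ι → ℂ}
    (hint : Integrable (fun w => star (x w) ⬝ᵥ (Φ w).mulVec (x w)) μ)
    (h0 : ∫ w, star (x w) ⬝ᵥ (Φ w).mulVec (x w) ∂μ = 0) : ∀ᵐ w ∂μ, x w = 0 := by
  have hre : ∫ w, (star (x w) ⬝ᵥ (Φ w).mulVec (x w)).re ∂μ = 0 :=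
    (integral_re hint).trans (congrArg Complex.re h0)
  have hnonneg : 0 ≤ᵐ[μ] fun w => (star (x w) ⬝ᵥ (Φ w).mulVec (x w)).re :=
    hpos.mono fun w hw => hw.posSemidef.re_dotProduct_nonneg (x w)
  filter_upwards [hpos, (integral_eq_zero_iff_of_nonneg_ae hnonneg hint.re).1 hre] with w hw hw0
  by_contra hx
  exact (Complex.lt_def.1 (hw.dotProduct_mulVec_pos hx)).1.ne' hw0

theorem eq_zero_of_spectralForm_eq_zero {ι : Type*} [Fintype ι] {Φ : ℝ → Matrix ι ι ℂ}
    (hΦ : ∀ a b, IntegrableOn (fun w => Φ w a b) (Set.Ioc (-Real.pi) Real.pi))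
    (hpos : ∀ᵐ w ∂volume.restrict (Set.Ioc (-Real.pi) Real.pi), (Φ w).PosDef) {f : ι → wiener ℝ}
    (h0 : ∑ a, ∑ b, ∫ w in Set.Ioc (-Real.pi) Real.pi,
      Φ w a b * freqResponse (f a) w * starRingEnd ℂ (freqResponse (f b) w) = 0) : f = 0 := by
  have hform : ∀ w, star (fun a => starRingEnd ℂ (freqResponse (f a) w)) ⬝ᵥ
      (Φ w).mulVec (fun a => starRingEnd ℂ (freqResponse (f a) w)) =
        ∑ a, ∑ b, Φ w a b * freqResponse (f a) w * starRingEnd ℂ (freqResponse (f b) w) :=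
    fun w => by
      simp only [dotProduct, Matrix.mulVec, Pi.star_apply, starRingEnd_apply, star_star,
        Finset.mul_sum, mul_left_comm, mul_assoc]
  have hint : ∀ a b, IntegrableOn (fun w => Φ w a b * freqResponse (f a) w *
      starRingEnd ℂ (freqResponse (f b) w)) (Set.Ioc (-Real.pi) Real.pi) := fun a b =>
    (integrable_mul_freqResponse (hΦ a b) (f a)).mul_bdd
      (Complex.continuous_conj.comp (continuous_freqResponse _)).aestronglyMeasurable
      (Eventually.of_forall fun w => by simpa using norm_freqResponse_le (f b) w)
  have hint_sum := integrable_finsetSum Finset.univ fun a _ =>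
    integrable_finsetSum Finset.univ fun b _ => hint a b
  have hresponse := ae_eq_zero_of_integral_posDef hpos
    (x := fun w a => starRingEnd ℂ (freqResponse (f a) w)) (by simpa only [hform] using hint_sum)
    (by
      simp only [hform]
      rw [integral_finsetSum _ fun a _ => integrable_finsetSum _ fun b _ => hint a b, ← h0]
      exact Finset.sum_congr rfl fun a _ => integral_finsetSum _ fun b _ => hint a b)
  exact funext fun a => eq_zero_of_freqResponse_ae_eq_zero <| hresponse.mono fun w hw =>
    (map_eq_zero (starRingEnd ℂ)).1 (congrFun hw a)

end Frequency

/-! ### Random signals as sequences in `L²` -/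

section Signals

variable {Ω α β : Type*} [MeasurableSpace Ω] {P : Measure Ω}

theorem inner_eq_integral {x y : Ω → ℝ} {X Y : Lp ℝ 2 P} (hx : x =ᵐ[P] X) (hy : y =ᵐ[P] Y) :
    ⟪X, Y⟫ = ∫ ω, x ω * y ω ∂P := by
  rw [L2.inner_def]
  refine integral_congr_ae ?_
  filter_upwards [hx, hy] with ω hxω hyω
  rw [hxω, hyω, mul_comm]
  rfl

theorem integrable_mul_of_ae_eq {x y : Ω → ℝ} {X Y : Lp ℝ 2 P} (hx : x =ᵐ[P] X)
    (hy : y =ᵐ[P] Y) : Integrable (fun ω => x ω * y ω) P := by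
  refine (L2.integrable_inner (𝕜 := ℝ) X Y).congr ?_
  filter_upwards [hx, hy] with ω hxω hyω
  rw [hxω, hyω, mul_comm]
  rfl

/-- The components of the random vector signal `s` are the sequences `K a` in `L²`, up to almost
sure equality. Boundedness of these sequences is the boundedness of second moments. -/
def IsRepresentedBy (P : Measure Ω) (s : ℤ → Ω → α → ℝ) (K : α → ℤ →ᵇ Lp ℝ 2 P) : Prop :=
  ∀ t a, (fun ω => s t ω a) =ᵐ[P] K a t

theorem IsQuasiStationary.exists_isRepresentedBy {s : ℤ → Ω → α → ℝ}
    (hs : IsQuasiStationary P s) : ∃ K, IsRepresentedBy P s K := by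
  obtain ⟨C, hC⟩ := hs.bounded
  have hnorm : ∀ t a, ‖(hs.memLp t a).toLp‖ ≤ √C := fun t a => by
    refine Real.le_sqrt_of_sq_le ?_
    rw [← real_inner_self_eq_norm_sq, inner_eq_integral (hs.memLp t a).coeFn_toLp.symm
      (hs.memLp t a).coeFn_toLp.symm]
    simpa only [sq] using hC t a
  exact ⟨fun a => BoundedContinuousFunction.ofNormedAddCommGroupDiscrete
    (fun t => (hs.memLp t a).toLp) _ fun t => hnorm t a, fun t a => (hs.memLp t a).coeFn_toLp.symm⟩

theorem tsum_impulse_mul_ae_eq {f : wiener ℝ} {x : ℤ → Ω → ℝ} {X : ℤ →ᵇ Lp ℝ 2 P}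
    (hx : ∀ t, x t =ᵐ[P] X t) (t : ℤ) :
    (fun ω => ∑' k : ℕ, PowerSeries.coeff k (f : ℝ⟦X⟧) * x (t - k) ω) =ᵐ[P] (f • X) t := by
  have hsum : Summable fun k : ℕ => ‖PowerSeries.coeff k (f : ℝ⟦X⟧) • X (t - k)‖ := by
    refine Summable.of_nonneg_of_le (fun _ => norm_nonneg _) (fun k => ?_)
      ((mem_wiener_iff.1 f.2).mul_right ‖X‖)
    rw [norm_smul]
    exact mul_le_mul_of_nonneg_left (X.norm_coe_le_norm _) (norm_nonneg _)
  have hfinite : ∑' k : ℕ, ‖PowerSeries.coeff k (f : ℝ⟦X⟧) • X (t - k)‖ₑ ≠ ⊤ := by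
    simpa only [ofReal_norm] using hsum.tsum_ofReal_ne_top
  have hterm : ∀ᵐ ω ∂P, ∀ k : ℕ, (PowerSeries.coeff k (f : ℝ⟦X⟧) • X (t - k) : Lp ℝ 2 P) ω =
      PowerSeries.coeff k (f : ℝ⟦X⟧) * x (t - k) ω := by
    refine ae_all_iff.2 fun k => ?_
    filter_upwards [Lp.coeFn_smul (PowerSeries.coeff k (f : ℝ⟦X⟧)) (X (t - k)), hx (t - k)]
      with ω hsmul hxω
    rw [hsmul, hxω, Pi.smul_apply, smul_eq_mul]
  rw [wiener_smul_apply]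
  filter_upwards [Lp.coeFn_tsum hfinite, hterm] with ω htsum hω
  rw [htsum]
  exact tsum_congr fun k => (hω k).symm

theorem hasGenExp_zero : HasGenExp P (fun _ _ => 0) 0 :=
  ⟨fun _ => integrable_zero Ω ℝ P, by simp⟩

namespace IsRepresentedBy

variable {s s' : ℤ → Ω → α → ℝ} {K K' : α → ℤ →ᵇ Lp ℝ 2 P}

theorem inner_eq (hs : IsRepresentedBy P s K) {r : ℤ → Ω → β → ℝ} {J : β → ℤ →ᵇ Lp ℝ 2 P}
    (hr : IsRepresentedBy P r J) (a : α) (b : β) (t t' : ℤ) :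
    ⟪K a t, J b t'⟫ = ∫ ω, s t ω a * r t' ω b ∂P :=
  inner_eq_integral (hs t a) (hr t' b)

theorem comp (hs : IsRepresentedBy P s K) (g : β → α) :
    IsRepresentedBy P (fun t ω => s t ω ∘ g) (K ∘ g) :=
  fun t b => hs t (g b)

theorem congr (hs : IsRepresentedBy P s K) (h : ∀ t, ∀ᵐ ω ∂P, s' t ω = s t ω) :
    IsRepresentedBy P s' K := fun t a => by
  filter_upwards [hs t a, h t] with ω hω h_eq
  rw [h_eq, hω]

theorem add (hs : IsRepresentedBy P s K) (hs' : IsRepresentedBy P s' K') :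
    IsRepresentedBy P (fun t ω => s t ω + s' t ω) (K + K') := fun t a => by
  filter_upwards [hs t a, hs' t a, Lp.coeFn_add (K a t) (K' a t)] with ω hω hω' hadd
  exact (congrArg₂ (· + ·) hω hω').trans hadd.symm

theorem sub (hs : IsRepresentedBy P s K) (hs' : IsRepresentedBy P s' K') :
    IsRepresentedBy P (fun t ω => s t ω - s' t ω) (K - K') := fun t a => by
  filter_upwards [hs t a, hs' t a, Lp.coeFn_sub (K a t) (K' a t)] with ω hω hω' hsub
  exact (congrArg₂ (· - ·) hω hω').trans hsub.symm

theorem sum [Fintype β] {s : β → ℤ → Ω → α → ℝ} {K : β → α → ℤ →ᵇ Lp ℝ 2 P}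
    (hs : ∀ b, IsRepresentedBy P (s b) (K b)) :
    IsRepresentedBy P (fun t ω => ∑ b, s b t ω) (∑ b, K b) := fun t a => by
  filter_upwards [ae_all_iff.2 fun b => hs b t a,
    Lp.coeFn_fun_finsetSum Finset.univ fun b => K b a t] with ω hω hsum
  rw [Finset.sum_apply, Finset.sum_apply, BoundedContinuousFunction.coe_sum, Finset.sum_apply,
    hsum]
  exact Finset.sum_congr rfl fun b _ => hω b

theorem filt [Fintype α] {f : Matrix β α (wiener ℝ)} {F : Matrix β α (RatFunc ℝ)}
    (hf : IsExpansion f F) (hs : IsRepresentedBy P s K) :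
    IsRepresentedBy P (filt F s) (f •ᵥ K) := by
  have hcolumn : ∀ a, IsRepresentedBy P
      (fun t ω b => ∑' k : ℕ, impulse (F b a) k * s (t - k) ω a) fun b => f b a • K a :=
    fun a t b => by
      simpa only [hf.impulse_eq] using tsum_impulse_mul_ae_eq (f := f b a) (fun t => hs t a) t
  intro t b
  have hsum := sum hcolumn t b
  simp only [Finset.sum_apply] at hsum
  exact hsum

theorem mulVec [Fintype α] (hs : IsRepresentedBy P s K) (Q : Matrix β α ℝ) :
    IsRepresentedBy P (fun t ω => Q.mulVec (s t ω)) (Q •ᵥ K) := by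
  have hcolumn : ∀ a, IsRepresentedBy P (fun t ω b => Q b a * s t ω a) fun b => Q b a • K a :=
    fun a t b => by
      filter_upwards [hs t a, Lp.coeFn_smul (Q b a) (K a t)] with ω hω hsmul
      rw [hω]
      exact hsmul.symm
  intro t b
  have hsum := sum hcolumn t b
  simp only [Finset.sum_apply] at hsum
  exact hsum

theorem hasGenExp_dotProduct_iff [Fintype α] (hs : IsRepresentedBy P s K)
    (hs' : IsRepresentedBy P s' K') {L : ℝ} :
    HasGenExp P (fun t ω => s t ω ⬝ᵥ s' t ω) L ↔
      Tendsto (fun N => ∑ a, avg N (K a) (K' a)) atTop (𝓝 L) := by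
  have hint : ∀ t a, Integrable (fun ω => s t ω a * s' t ω a) P := fun t a =>
    integrable_mul_of_ae_eq (hs t a) (hs' t a)
  have hexpect : ∀ t, ∫ ω, s t ω ⬝ᵥ s' t ω ∂P = ∑ a, ⟪K a t, K' a t⟫ := fun t => by
    simp only [dotProduct, hs.inner_eq hs', integral_finsetSum _ fun a _ => hint t a]
  have hdot : ∀ t, Integrable (fun ω => s t ω ⬝ᵥ s' t ω) P := fun t =>
    integrable_finsetSum _ fun a _ => hint t a
  have havg : ∀ N, ∑ a, avg N (K a) (K' a) =
      (N : ℝ)⁻¹ * ∑ t ∈ Finset.Icc 1 N, ∑ a, ⟪K a (t : ℤ), K' a (t : ℤ)⟫ := fun N => by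
    simp only [avg_apply, ← Finset.mul_sum]
    rw [Finset.sum_comm]
  simp only [HasGenExp, hexpect, havg, and_iff_right hdot]

theorem hasGenExp_quadraticForm_iff [Fintype α] (hs : IsRepresentedBy P s K) (Q : Matrix α α ℝ)
    {L : ℝ} : HasGenExp P (fun t ω => s t ω ⬝ᵥ Q.mulVec (s t ω)) L ↔
      Tendsto (fun N => weightedAvg Q N K) atTop (𝓝 L) :=
  hs.hasGenExp_dotProduct_iff (hs.mulVec Q)

theorem hasGenExp_sq_zero_iff (hs : IsRepresentedBy P s K) (a : α) :
    HasGenExp P (fun t ω => s t ω a ^ 2) 0 ↔ K a ∈ negligible (Lp ℝ 2 P) := by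
  have h := (hs.comp fun _ : Unit => a).hasGenExp_dotProduct_iff (hs.comp fun _ : Unit => a)
    (L := 0)
  rw [mem_negligible_iff]
  simpa [dotProduct, ← sq] using h

theorem tendsto_avg (hs : IsRepresentedBy P s K) {R : ℤ → Matrix α α ℝ}
    (hR : HasCovariance P s R) (τ : ℤ) (a b : α) :
    Tendsto (fun N => avg N (K a) (delay τ (K b))) atTop (𝓝 (R τ a b)) := by
  simpa only [avg_apply, delay_apply, hs.inner_eq hs] using (hR τ a b).2

end IsRepresentedBy

end Signals

/-! ### Identifiability under a positive definite spectral density -/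

section Identifiability

variable {Ω α ι : Type*} [MeasurableSpace Ω] {P : Measure Ω} [Fintype ι]

theorem HasSpectralDensity.eq_zero_of_mem_negligible {s : ℤ → Ω → ι → ℝ}
    {Φ : ℝ → Matrix ι ι ℂ} (hΦ : HasSpectralDensity P s Φ)
    (hpos : ∀ᵐ w ∂volume.restrict (Set.Ioc (-Real.pi) Real.pi), (Φ w).PosDef)
    {K : ι → ℤ →ᵇ Lp ℝ 2 P} (hs : IsRepresentedBy P s K) {f : Matrix α ι (wiener ℝ)} {a : α}
    (hf : matSMul f K a ∈ negligible (Lp ℝ 2 P)) : f a = 0 := by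
  obtain ⟨hint, R, hR, hRΦ⟩ := hΦ
  have hpower := tendsto_nhds_unique
    (tendsto_avg_matSMul_matSMul f f (fun τ b b' => hs.tendsto_avg hR τ b b') a a)
    (mem_negligible_iff.1 hf)
  have hfourier : ∀ b b', ((∑' l : ℕ, PowerSeries.coeff l (f a b' : ℝ⟦X⟧) *
      ∑' k : ℕ, PowerSeries.coeff k (f a b : ℝ⟦X⟧) * R (l - k) b b' : ℝ) : ℂ) =
        (2 * (Real.pi : ℂ))⁻¹ * ∫ w in Set.Ioc (-Real.pi) Real.pi,
          Φ w b b' * freqResponse (f a b) w * starRingEnd ℂ (freqResponse (f a b') w) :=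
    fun b b' => tsum_coeff_mul_tsum_coeff_mul (R := fun τ => R τ b b') (hint b b') _ _ fun τ => by
      rw [hRΦ, intervalIntegral.integral_of_le (by linarith [Real.pi_pos])]
      rfl
  refine eq_zero_of_spectralForm_eq_zero hint hpos ?_
  have h := congrArg Complex.ofReal hpower
  simp only [Complex.ofReal_sum, hfourier, ← Finset.mul_sum, Complex.ofReal_zero] at h
  exact (mul_eq_zero.1 h).resolve_left (by simp [Real.pi_ne_zero])

theorem HasSpectralDensity.row_eq_of_hasGenExp_sq_filt_sub {s : ℤ → Ω → ι → ℝ} {S : Set ι}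
    {Φ : ℝ → Matrix S S ℂ} (hΦ : HasSpectralDensity P (select S s) Φ)
    (hpos : ∀ᵐ w ∂volume.restrict (Set.Ioc (-Real.pi) Real.pi), (Φ w).PosDef)
    (hs : IsQuasiStationary P s) {F F' : Matrix α ι (RatFunc ℝ)} (hF : IsStableMatrix F)
    (hF' : IsStableMatrix F') {a : α} (hS : ∀ c ∉ S, F a c = F' a c)
    (h0 : HasGenExp P (fun t ω => filt (F - F') s t ω a ^ 2) 0) : F a = F' a := by
  classical
  obtain ⟨K, hK⟩ := hs.exists_isRepresentedBy
  obtain ⟨f, hf⟩ := hF.exists_isExpansion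
  obtain ⟨f', hf'⟩ := hF'.exists_isExpansion
  have hδ := hf.sub hf'
  have heq_iff : ∀ c, (f - f') a c = 0 ↔ F a c = F' a c := fun c =>
    (hδ.eq_zero_iff a c).trans sub_eq_zero
  have hrestrict : ((f - f') •ᵥ K) a =
      ((f - f').submatrix id (Subtype.val : S → ι) •ᵥ (K ∘ Subtype.val)) a := by
    refine (Finset.sum_subset (Finset.subset_univ S.toFinset) fun c _ hc => ?_).symm.trans
      (Finset.sum_set_coe S (f := fun c => (f - f') a c • K c)).symm
    rw [(heq_iff c).2 (hS c fun h => hc (Set.mem_toFinset.2 h)), zero_smul]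
  have hnegligible := ((hK.filt hδ).hasGenExp_sq_zero_iff a).1 h0
  rw [hrestrict] at hnegligible
  have hS0 := hΦ.eq_zero_of_mem_negligible hpos (hK.comp Subtype.val) hnegligible
  funext c
  by_cases hc : c ∈ S
  · exact (heq_iff c).1 (congrFun hS0 ⟨c, hc⟩)
  · exact hS c hc

end Identifiability

/-! ### The prediction-error cost of a model -/

section Noise

variable {E : Type*} [NormedAddCommGroup E] [InnerProductSpace ℝ E] [CompleteSpace E]

theorem inner_wiener_smul_eq_zero {f : wiener ℝ} {v : E} {x : ℤ →ᵇ E} {t : ℤ}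
    (h : ∀ k : ℕ, PowerSeries.coeff k (f : ℝ⟦X⟧) = 0 ∨ ⟪v, x (t - k)⟫ = 0) :
    ⟪v, (f • x) t⟫ = 0 := by
  have hsum := ((hasSum_wiener_smul f x).mapL (BoundedContinuousFunction.evalCLM ℝ t)).mapL
    (innerSL ℝ v)
  refine hsum.unique ?_
  have hterm : ∀ k : ℕ, PowerSeries.coeff k (f : ℝ⟦X⟧) * ⟪v, x (t - k)⟫ = 0 := fun k =>
    mul_eq_zero.2 (h k)
  simp [hterm]

end Noise

section Cost

variable {Ω : Type*} [MeasurableSpace Ω] {P : Measure Ω} {m p : ℕ}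
  {u : ℤ → Ω → Fin m → ℝ} {e : ℤ → Ω → Fin p → ℝ} {K : Fin m ⊕ Fin p → ℤ →ᵇ Lp ℝ 2 P}
  {Λ : Matrix (Fin p) (Fin p) ℝ}

theorem inner_noise_matSMul_eq_zero (he : IsWhiteNoise P e Λ)
    (hue : ∀ s t : ℤ, s ≤ t → ∀ k i, ∫ ω, u s ω k * e t ω i ∂P = 0)
    (hκ : IsRepresentedBy P (kappa u e) K) {α : Type*}
    {d : Matrix α (Fin m ⊕ Fin p) (wiener ℝ)} {b : α}
    (hd : ∀ i, PowerSeries.coeff 0 (d b (Sum.inr i) : ℝ⟦X⟧) = 0) (a : Fin p) (t : ℤ) :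
    ⟪K (Sum.inr a) t, (d •ᵥ K) b t⟫ = 0 := by
  have hinput : ∀ c (k : ℕ), ⟪K (Sum.inr a) t, K (Sum.inl c) (t - k)⟫ = 0 := fun c k => by
    rw [real_inner_comm, hκ.inner_eq hκ]
    exact hue (t - k) t (by omega) c a
  have hnoise : ∀ i (k : ℕ), k ≠ 0 → ⟪K (Sum.inr a) t, K (Sum.inr i) (t - k)⟫ = 0 :=
    fun i k hk => by
      rw [hκ.inner_eq hκ]
      exact he.uncorrelated t (t - k) (by omega) a i
  rw [matSMul_apply, BoundedContinuousFunction.coe_sum, Finset.sum_apply, inner_sum]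
  refine Finset.sum_eq_zero fun c _ => inner_wiener_smul_eq_zero fun k => ?_
  rcases c with c | i
  · exact .inr (hinput c k)
  · rcases eq_or_ne k 0 with rfl | hk
    exacts [.inl (hd i), .inr (hnoise i k hk)]

theorem avg_noise_eq (he : IsWhiteNoise P e Λ) (hκ : IsRepresentedBy P (kappa u e) K)
    {N : ℕ} (hN : N ≠ 0) (a b : Fin p) : avg N (K (Sum.inr a)) (K (Sum.inr b)) = Λ a b := by
  have hcov : ∀ t : ℤ, ⟪K (Sum.inr a) t, K (Sum.inr b) t⟫ = Λ a b := fun t =>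
    (hκ.inner_eq hκ _ _ t t).trans (he.covariance t a b)
  simp [avg_apply, hcov, hN]

theorem tendsto_avg_noise_add_noise_add (he : IsWhiteNoise P e Λ)
    (hκ : IsRepresentedBy P (kappa u e) K) {v : Fin p → ℤ →ᵇ Lp ℝ 2 P}
    (horth : ∀ a b t, ⟪K (Sum.inr a) t, v b t⟫ = 0) {W : Matrix (Fin p) (Fin p) ℝ}
    (hW : ∀ a b, Tendsto (fun N => avg N (v a) (v b)) atTop (𝓝 (W a b))) (a b : Fin p) :
    Tendsto (fun N => avg N ((K ∘ Sum.inr + v) a) ((K ∘ Sum.inr + v) b)) atTop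
      (𝓝 ((Λ + W) a b)) := by
  have hcross : ∀ N a b, avg N (K (Sum.inr a)) (v b) = 0 := fun N a b => by
    simp only [avg_apply, horth, Finset.sum_const_zero, mul_zero]
  refine ((hW a b).const_add (Λ a b)).congr' ?_
  filter_upwards [eventually_ne_atTop 0] with N hN
  simp only [Pi.add_apply, Function.comp_apply, map_add, add_apply, hcross, avg_noise_eq he hκ hN,
    avg_comm N (v a) (K (Sum.inr b)), add_zero, zero_add]

theorem IsMonic.coeff_zero_eq {H : Matrix (Fin p) (Fin p) (RatFunc ℝ)} (hH : IsMonic H)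
    {h : Matrix (Fin p) (Fin p) (wiener ℝ)} (hh : IsExpansion h H) (a b : Fin p) :
    PowerSeries.coeff 0 (h a b : ℝ⟦X⟧) = (1 : Matrix (Fin p) (Fin p) ℝ) a b := by
  rw [← hh.impulse_eq, hH.2]

theorem coeff_zero_mul_mismatch_eq_zero {H₀ H : Matrix (Fin p) (Fin p) (RatFunc ℝ)}
    (hH₀ : IsMonic H₀) (hH : IsMonic H) {g₀ g : Matrix (Fin p) (Fin m) (wiener ℝ)}
    {h₀ h : Matrix (Fin p) (Fin p) (wiener ℝ)} (hh₀ : IsExpansion h₀ H₀) (hh : IsExpansion h H)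
    {α : Type*} (f : Matrix α (Fin p) (wiener ℝ)) (b : α) (i : Fin p) :
    PowerSeries.coeff 0
      ((f * (Matrix.fromCols g₀ h₀ - Matrix.fromCols g h)) b (Sum.inr i) : ℝ⟦X⟧) = 0 := by
  have hcancel : ∀ c, PowerSeries.coeff 0 (h₀ c i : ℝ⟦X⟧) = PowerSeries.coeff 0 (h c i : ℝ⟦X⟧) :=
    fun c => by rw [hH₀.coeff_zero_eq hh₀, hH.coeff_zero_eq hh]
  simp only [PowerSeries.coeff_zero_eq_constantCoeff_apply] at hcancel ⊢
  simp [Matrix.mul_apply, hcancel]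

theorem isRepresentedBy_predictionError {G₀ G : Matrix (Fin p) (Fin m) (RatFunc ℝ)}
    {H₀ H : Matrix (Fin p) (Fin p) (RatFunc ℝ)} {g₀ g : Matrix (Fin p) (Fin m) (wiener ℝ)}
    {h₀ h hi : Matrix (Fin p) (Fin p) (wiener ℝ)} (hg₀ : IsExpansion g₀ G₀)
    (hh₀ : IsExpansion h₀ H₀) (hg : IsExpansion g G) (hhi : IsExpansion hi H⁻¹) (hinv : hi * h = 1)
    {y : ℤ → Ω → Fin p → ℝ} (hy : ∀ t, ∀ᵐ ω ∂P, y t ω = filt G₀ u t ω + filt H₀ e t ω)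
    (hκ : IsRepresentedBy P (kappa u e) K) :
    IsRepresentedBy P (predictionError G H y u)
      (K ∘ Sum.inr + (hi * (Matrix.fromCols g₀ h₀ - Matrix.fromCols g h)) •ᵥ K) := by
  have hu : IsRepresentedBy P u (K ∘ Sum.inl) := hκ.comp Sum.inl
  have he : IsRepresentedBy P e (K ∘ Sum.inr) := hκ.comp Sum.inr
  have hY : IsRepresentedBy P y (Matrix.fromCols g₀ h₀ •ᵥ K) := by
    rw [fromCols_matSMul]
    exact ((hu.filt hg₀).add (he.filt hh₀)).congr hy
  rw [← sub_predictor_eq hinv K rfl]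
  exact hY.sub ((hY.filt (isExpansion_one.sub hhi)).add (hu.filt (hhi.mul hg)))

theorem exists_hasGenExp_predictionError {G₀ G : Matrix (Fin p) (Fin m) (RatFunc ℝ)}
    {H₀ H : Matrix (Fin p) (Fin p) (RatFunc ℝ)}
    (hG₀ : IsStableMatrix G₀) (hH₀ : IsNoiseModel H₀) (hG : IsStableMatrix G)
    (hH : IsNoiseModel H) {y : ℤ → Ω → Fin p → ℝ} (he : IsWhiteNoise P e Λ)
    (hκ : IsQuasiStationary P (kappa u e))
    (hue : ∀ s t : ℤ, s ≤ t → ∀ k i, ∫ ω, u s ω k * e t ω i ∂P = 0)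
    (hy : ∀ t, ∀ᵐ ω ∂P, y t ω = filt G₀ u t ω + filt H₀ e t ω)
    {Q : Matrix (Fin p) (Fin p) ℝ} (hQ : Q.PosDef) :
    ∃ L, 0 ≤ L ∧
      HasGenExp P (fun t ω => predictionError G H y u t ω ⬝ᵥ
        Q.mulVec (predictionError G H y u t ω)) (∑ a, ∑ b, Q a b * Λ a b + L) ∧
      (L = 0 ↔ ∀ a, HasGenExp P (fun t ω =>
        filt (Matrix.fromCols G₀ H₀ - Matrix.fromCols G H) (kappa u e) t ω a ^ 2) 0) := by
  obtain ⟨K, hK⟩ := hκ.exists_isRepresentedBy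
  obtain ⟨R, hR⟩ := hκ.covariance
  obtain ⟨g₀, hg₀⟩ := hG₀.exists_isExpansion
  obtain ⟨h₀, hh₀⟩ := hH₀.stable.exists_isExpansion
  obtain ⟨g, hg⟩ := hG.exists_isExpansion
  obtain ⟨h, hi, hh, hhi, hinv⟩ := hH.exists_isExpansion_inv
  set δ := Matrix.fromCols g₀ h₀ - Matrix.fromCols g h
  obtain ⟨W, hW⟩ : ∃ W : Matrix (Fin p) (Fin p) ℝ, ∀ a b,
      Tendsto (fun N => avg N (((hi * δ) •ᵥ K) a) (((hi * δ) •ᵥ K) b)) atTop (𝓝 (W a b)) :=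
    ⟨_, tendsto_avg_matSMul_matSMul (hi * δ) (hi * δ) (hK.tendsto_avg hR)⟩
  have hε := isRepresentedBy_predictionError hg₀ hh₀ hg hhi hinv hy hK
  have hδ : IsRepresentedBy P (filt (Matrix.fromCols G₀ H₀ - Matrix.fromCols G H) (kappa u e))
      (δ •ᵥ K) := hK.filt ((hg₀.fromCols hh₀).sub (hg.fromCols hh))
  have hcost := tendsto_weightedAvg Q (tendsto_avg_noise_add_noise_add he hK
    (fun a b => inner_noise_matSMul_eq_zero he hue hK
      (coeff_zero_mul_mismatch_eq_zero hH₀.monic hH.monic hh₀ hh hi b) a) hW)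
  have hexcess := tendsto_weightedAvg Q hW
  refine ⟨∑ a, ∑ b, Q a b * W a b, ge_of_tendsto' hexcess fun N => weightedAvg_nonneg hQ N _,
    (hε.hasGenExp_quadraticForm_iff Q).2 ?_, ?_⟩
  · simpa only [Matrix.add_apply, mul_add, Finset.sum_add_distrib] using hcost
  · calc
      ∑ a, ∑ b, Q a b * W a b = 0
          ↔ Tendsto (fun N => weightedAvg Q N ((hi * δ) •ᵥ K)) atTop (𝓝 0) :=
        ⟨fun h0 => h0 ▸ hexcess, tendsto_nhds_unique hexcess⟩
      _ ↔ ∀ a, ((hi * δ) •ᵥ K) a ∈ negligible (Lp ℝ 2 P) := tendsto_weightedAvg_zero_iff hQ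
      _ ↔ ∀ a, (δ •ᵥ K) a ∈ negligible (Lp ℝ 2 P) := by
        rw [mul_matSMul, forall_matSMul_mem_iff (mul_eq_one_comm.1 hinv)]
      _ ↔ _ := forall_congr' fun a => (hδ.hasGenExp_sq_zero_iff a).symm

end Cost

theorem apply_eq_of_notMem_nonzeroColumns {n : ℕ} {α β γ : Type*} [Zero γ] {Θ : Set (Fin n → ℝ)}
    {M : (Fin n → ℝ) → Matrix α β γ} {j : α} {c : β} (hc : c ∉ nonzeroColumns Θ M j)
    {θ θ' : Fin n → ℝ} (hθ : θ ∈ Θ) (hθ' : θ' ∈ Θ) : M θ j c = M θ' j c := by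
  have hzero : ∀ θ ∈ Θ, M θ j c = 0 := fun θ hθ => not_not.1 fun h => hc ⟨θ, hθ, h⟩
  rw [hzero θ hθ, hzero θ' hθ']

theorem apply_eq_of_notMem_parametrizedColumns {n : ℕ} {α β γ : Type*} {Θ : Set (Fin n → ℝ)}
    {M : (Fin n → ℝ) → Matrix α β γ} {j : α} {c : β} (hc : c ∉ parametrizedColumns Θ M j)
    {θ θ' : Fin n → ℝ} (hθ : θ ∈ Θ) (hθ' : θ' ∈ Θ) : M θ j c = M θ' j c :=
  not_not.1 fun h => hc ⟨θ, hθ, θ', hθ', h⟩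

end PredErr

end

theorem proposition2_general
    {Ω : Type*} [MeasurableSpace Ω] {P : Measure Ω} {m p : ℕ} {𝓣 : Type*} {Θ : Set 𝓣}
    {G : 𝓣 → Matrix (Fin p) (Fin m) (RatFunc ℝ)} {H : 𝓣 → Matrix (Fin p) (Fin p) (RatFunc ℝ)}
    (hG : ∀ θ ∈ Θ, PredErr.IsStableMatrix (G θ)) (hH : ∀ θ ∈ Θ, PredErr.IsNoiseModel (H θ))
    {θ₀ : 𝓣} (hθ₀ : θ₀ ∈ Θ)
    {y : ℤ → Ω → Fin p → ℝ} {u : ℤ → Ω → Fin m → ℝ} {e : ℤ → Ω → Fin p → ℝ}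
    {Λ : Matrix (Fin p) (Fin p) ℝ} (he : PredErr.IsWhiteNoise P e Λ)
    (hκ : PredErr.IsQuasiStationary P (PredErr.kappa u e))
    (hue : ∀ s t : ℤ, s ≤ t → ∀ k i, ∫ ω, u s ω k * e t ω i ∂P = 0)
    (hy : ∀ t, ∀ᵐ ω ∂P, y t ω = PredErr.filt (G θ₀) u t ω + PredErr.filt (H θ₀) e t ω)
    {Q : Matrix (Fin p) (Fin p) ℝ} (hQ : Q.PosDef) {j : Fin p} {S : Set (Fin m ⊕ Fin p)}
    (hS : ∀ c ∉ S, ∀ θ ∈ Θ,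
      Matrix.fromCols (G θ₀) (H θ₀) j c = Matrix.fromCols (G θ) (H θ) j c)
    {Φ : ℝ → Matrix S S ℂ}
    (hΦ : PredErr.HasSpectralDensity P (PredErr.select S (PredErr.kappa u e)) Φ)
    (hpos : ∀ᵐ w ∂(volume.restrict (Set.Ioc (-Real.pi) Real.pi)), (Φ w).PosDef) :
    ∃ V : 𝓣 → ℝ,
      (∀ θ ∈ Θ, PredErr.HasGenExp P
        (fun t ω => PredErr.predictionError (G θ) (H θ) y u t ω ⬝ᵥ
          Q.mulVec (PredErr.predictionError (G θ) (H θ) y u t ω)) (V θ)) ∧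
      {r | ∃ θ ∈ Θ, IsMinOn V Θ θ ∧ Matrix.fromCols (G θ) (H θ) j = r} =
        {Matrix.fromCols (G θ₀) (H θ₀) j} := by
  have hM : ∀ θ ∈ Θ, PredErr.IsStableMatrix (Matrix.fromCols (G θ) (H θ)) := fun θ hθ =>
    (hG θ hθ).fromCols (hH θ hθ).stable
  choose! L hL_nonneg hL_cost hL_zero using fun θ (hθ : θ ∈ Θ) =>
    PredErr.exists_hasGenExp_predictionError (hG θ₀ hθ₀) (hH θ₀ hθ₀) (hG θ hθ) (hH θ hθ)
      he hκ hue hy hQ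
  have hL_true : L θ₀ = 0 := (hL_zero θ₀ hθ₀).2 fun a => by
    simpa [PredErr.filt_zero] using PredErr.hasGenExp_zero
  refine ⟨_, hL_cost, Set.eq_singleton_iff_unique_mem.2 ⟨⟨θ₀, hθ₀, fun θ hθ => ?_, rfl⟩, ?_⟩⟩
  · simpa only [Set.mem_ofPred_eq, hL_true, add_le_add_iff_left] using hL_nonneg θ hθ
  · rintro _ ⟨θ, hθ, hmin, rfl⟩
    have hL_le : L θ ≤ 0 := by
      simpa only [Set.mem_ofPred_eq, hL_true, add_le_add_iff_left] using hmin hθ₀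
    exact (hΦ.row_eq_of_hasGenExp_sq_filt_sub hpos hκ (hM θ₀ hθ₀) (hM θ hθ)
      (fun c hc => hS c hc θ hθ)
      ((hL_zero θ hθ).1 (hL_le.antisymm (hL_nonneg θ hθ)) j)).symm

theorem proposition2
    {Ω : Type*} [MeasurableSpace Ω] (P : Measure Ω) [IsProbabilityMeasure P]
    {m p n : ℕ}
    -- the data generating system and its signals
    (G₀ : Matrix (Fin p) (Fin m) (RatFunc ℝ)) (H₀ : Matrix (Fin p) (Fin p) (RatFunc ℝ))
    (hG₀ : PredErr.IsStableMatrix G₀) (hH₀ : PredErr.IsNoiseModel H₀)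
    (y : ℤ → Ω → Fin p → ℝ) (u : ℤ → Ω → Fin m → ℝ) (e : ℤ → Ω → Fin p → ℝ)
    (Λ : Matrix (Fin p) (Fin p) ℝ) (he : PredErr.IsWhiteNoise P e Λ)
    (hκ : PredErr.IsQuasiStationary P (PredErr.kappa u e))
    (hue : ∀ s t : ℤ, s ≤ t → ∀ k i, ∫ ω, u s ω k * e t ω i ∂P = 0)
    (hy : ∀ t, ∀ᵐ ω ∂P, y t ω = PredErr.filt G₀ u t ω + PredErr.filt H₀ e t ω)
    -- the parametrized model, which contains the system
    (Θ : Set (Fin n → ℝ))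
    (G : (Fin n → ℝ) → Matrix (Fin p) (Fin m) (RatFunc ℝ))
    (H : (Fin n → ℝ) → Matrix (Fin p) (Fin p) (RatFunc ℝ))
    (hG : ∀ θ ∈ Θ, PredErr.IsStableMatrix (G θ))
    (hH : ∀ θ ∈ Θ, PredErr.IsNoiseModel (H θ))
    (hsys : ∃ θ₀ ∈ Θ, G θ₀ = G₀ ∧ H θ₀ = H₀)
    -- the weighting matrix of the cost
    (Q : Matrix (Fin p) (Fin p) ℝ) (hQ : Q.PosDef)
    -- the row of interest
    (j : Fin p) (hrow : PredErr.RowIndependent Θ (PredErr.modelMatrix G H) j)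
    -- the signals of the row, and their spectral density
    (S : Set (Fin m ⊕ Fin p))
    (hS : S = PredErr.nonzeroColumns Θ (PredErr.modelMatrix G H) j ∨
      S = PredErr.parametrizedColumns Θ (PredErr.modelMatrix G H) j)
    (Φ : ℝ → Matrix S S ℂ)
    (hΦ : PredErr.HasSpectralDensity P (PredErr.select S (PredErr.kappa u e)) Φ)
    (hpos : ∀ᵐ w ∂(volume.restrict (Set.Ioc (-Real.pi) Real.pi)), (Φ w).PosDef) :
    ∃ V : (Fin n → ℝ) → ℝ,
      PredErr.IsPredictionErrorCost P Θ G H Q y u V ∧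
      {r | ∃ θ ∈ Θ, IsMinOn V Θ θ ∧ PredErr.modelMatrix G H θ j = r} =
        {Matrix.fromCols G₀ H₀ j} := by
  obtain ⟨θ₀, hθ₀, rfl, rfl⟩ := hsys
  refine proposition2_general hG hH hθ₀ he hκ hue hy hQ (fun c hc θ hθ => ?_) hΦ hpos
  rcases hS with rfl | rfl
  exacts [PredErr.apply_eq_of_notMem_nonzeroColumns hc hθ₀ hθ,
    PredErr.apply_eq_of_notMem_parametrizedColumns hc hθ₀ hθ]
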